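/- \textbf{Proposition (Alternative Definition of Nearly Calabi--Yau).} Let $\pi:P\to M$ be a smooth $SU(3)$-structure on a smooth $6$-manifold $M$: a principal right $SU(3)$-bundle whose points $u\in P_x$ are real linear isomorphisms $u:T_xM\to\mathbf{C}^3$ (a smooth subbundle of the coframe bundle), with right action $u\cdot a=a^{-1}\circ u$. Let $\Omega$ and $\Psi$ be the forms on $M$ given by $\Omega_x=u^*\Omega_0$, $\Psi_x=u^*\Psi_0$ for any $u\in P_x$, where $\Omega_0=\frac{\sqrt{-1}}{2}\sum_{i=1}^3 dz_i\wedge d\overline{z_i}$ and $\Psi_0=dz_1\wedge dz_2\wedge dz_3$. Let $\omega=(\omega_1,\omega_2,\omega_3)^t$ be the tautological $\mathbf{C}^3$-valued $1$-form on $P$, $\omega_u(X)=u(\pi_*X)$. The structure is called nearly Calabi--Yau if $$d\Omega=0\quad\text{and}\quad d(\mathrm{Im}\,\Psi)=0 .$$ Then the structure is nearly Calabi--Yau if and only if there exists a connection form $\alpha=(\alpha_{i\overline{j}})$ on $P$ (a smooth $\mathfrak{su}(3)$-valued $1$-form which reproduces the generators of the right action and satisfies $R_a^*\alpha=a^{-1}\alpha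 a$ for $a\in SU(3)$) and a function $N=(N_{i\overline{j}})$ on $P$ with values in the complex $3\times 3$ matrices such that on $P$ $$d\omega_i=-\sum_j\alpha_{i\overline{j}}\wedge\omega_j+\frac12\sum_{j,k,l}N_{i\overline{j}}\,\epsilon_{jkl}\,\overline{\omega_k\wedge\omega_l}\qquad(i=1,2,3),$$ $$N_{i\overline{j}}=\overline{N_{j\overline{i}}}\quad\text{and}\quad \sum_i N_{i\overline{i}}=0 .$$ Here $\epsilon_{jkl}$ is the signature of the permutation $(jkl)$, and $0$ if two of the indices coincide. Moreover, a connection $\alpha$ with these properties is necessarily unique. -/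

import Mathlib

open scoped Manifold ContDiff Matrix

noncomputable section

/-! ### Wedge products of covectors and the exterior derivative on a manifold -/

section Forms

variable {V : Type*} [AddCommGroup V] [Module ℝ V] [TopologicalSpace V]

/-- The wedge product `θ₁ ∧ ⋯ ∧ θₖ` of complex valued covectors, in the convention
`θ ∧ η = θ ⊗ η - η ⊗ θ`; that is, `(v₁, …, vₖ) ↦ det (θᵢ (vⱼ))`. -/
def wedge {k : ℕ} (θ : Fin k → (V →L[ℝ] ℂ)) : V [⋀^Fin k]→L[ℝ] ℂ :=
  (ContinuousAlternatingMap.restrictScalars ℝ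
    ({ (Matrix.detRowAlternating : (Fin k → ℂ) [⋀^Fin k]→ₗ[ℂ] ℂ) with
        cont := (continuous_id.matrix_det :
          Continuous fun A : Matrix (Fin k) (Fin k) ℂ => A.det) } :
      (Fin k → ℂ) [⋀^Fin k]→L[ℂ] ℂ)).compContinuousLinearMap (ContinuousLinearMap.pi θ)

theorem wedge_apply {k : ℕ} (θ : Fin k → (V →L[ℝ] ℂ)) (v : Fin k → V) :
    wedge θ v = Matrix.det (Matrix.of fun i j => θ i (v j)) :=
  (Matrix.det_transpose (Matrix.of fun i j => θ i (v j)))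

/-- The complex conjugate of a complex valued covector. -/
def conjForm (θ : V →L[ℝ] ℂ) : V →L[ℝ] ℂ :=
  (Complex.conjCLE : ℂ →L[ℝ] ℂ).comp θ

end Forms

/-- The exterior derivative of a differential `k`-form on an `n`-dimensional manifold, computed at
`x` in the preferred chart `φ` at `x`: `(dθ)_x = φ^* (d ((φ⁻¹)^* θ))`. -/
def mextDeriv {n : ℕ} {X : Type*} [TopologicalSpace X]
    [ChartedSpace (EuclideanSpace ℝ (Fin n)) X]
    {F : Type*} [NormedAddCommGroup F] [NormedSpace ℝ F] {k : ℕ}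
    (θ : ∀ x : X, TangentSpace (𝓡 n) x [⋀^Fin k]→L[ℝ] F) (x : X) :
    TangentSpace (𝓡 n) x [⋀^Fin (k + 1)]→L[ℝ] F :=
  ContinuousAlternatingMap.compContinuousLinearMap
    (M := EuclideanSpace ℝ (Fin n))
    (extDeriv
      (fun y : EuclideanSpace ℝ (Fin n) =>
        (θ ((extChartAt (𝓡 n) x).symm y)).compContinuousLinearMap
          (mfderiv 𝓘(ℝ, EuclideanSpace ℝ (Fin n)) (𝓡 n) (extChartAt (𝓡 n) x).symm y))
      (extChartAt (𝓡 n) x x))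
    (mfderiv (𝓡 n) 𝓘(ℝ, EuclideanSpace ℝ (Fin n)) (extChartAt (𝓡 n) x) x)

/-- A complex valued differential 1-form, given by its value at each point as a linear form, is
regarded as an alternating form of degree 1. -/
def oneForm {n : ℕ} {X : Type*} [TopologicalSpace X]
    [ChartedSpace (EuclideanSpace ℝ (Fin n)) X]
    (θ : ∀ x : X, TangentSpace (𝓡 n) x →L[ℝ] ℂ) (x : X) :
    TangentSpace (𝓡 n) x [⋀^Fin 1]→L[ℝ] ℂ :=
  ContinuousAlternatingMap.ofSubsingleton ℝ (TangentSpace (𝓡 n) x) ℂ (0 : Fin 1) (θ x)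

/-- Smoothness of a complex valued differential 1-form, as a section of the bundle
`Hom(TX, ℂ)`. -/
def IsSmoothOneForm {n : ℕ} {X : Type*} [TopologicalSpace X]
    [ChartedSpace (EuclideanSpace ℝ (Fin n)) X] [IsManifold (𝓡 n) ∞ X]
    (θ : ∀ x : X, TangentSpace (𝓡 n) x →L[ℝ] ℂ) : Prop :=
  ContMDiff (𝓡 n) ((𝓡 n).prod 𝓘(ℝ, EuclideanSpace ℝ (Fin n) →L[ℝ] ℂ)) ∞
    (fun x => (⟨x, θ x⟩ : Bundle.TotalSpace (EuclideanSpace ℝ (Fin n) →L[ℝ] ℂ)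
      (fun x : X => TangentSpace (𝓡 n) x →L[ℝ] Bundle.Trivial X ℂ x)))

/-! ### The standard forms on `ℂ³` -/

/-- `ε_{jkl}`: the signature of the permutation `(j k l)`, and `0` if `j, k, l` are not distinct. -/
def epsilon (j k l : Fin 3) : ℂ :=
  ∑ σ : Equiv.Perm (Fin 3),
    if σ 0 = j ∧ σ 1 = k ∧ σ 2 = l then ((Equiv.Perm.sign σ : ℤ) : ℂ) else 0

/-- The coordinate covector `dzᵢ` on `ℂ³`, as a real linear map. -/
def dz (i : Fin 3) : (Fin 3 → ℂ) →L[ℝ] ℂ := ContinuousLinearMap.proj i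

/-- `Ω₀ = (√-1 / 2) (dz₁ ∧ dz̄₁ + dz₂ ∧ dz̄₂ + dz₃ ∧ dz̄₃)`. -/
def Omega0 : (Fin 3 → ℂ) [⋀^Fin 2]→L[ℝ] ℂ :=
  (Complex.I / 2) • ∑ i : Fin 3, wedge ![dz i, conjForm (dz i)]

/-- `Ψ₀ = dz₁ ∧ dz₂ ∧ dz₃`. -/
def Psi0 : (Fin 3 → ℂ) [⋀^Fin 3]→L[ℝ] ℂ := wedge dz

/-- The group `SU(3)`. -/
abbrev SU3 : Type := Matrix.specialUnitaryGroup (Fin 3) ℂ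

theorem Omega0_apply (v : Fin 2 → Fin 3 → ℂ) :
    Omega0 v = Complex.I / 2 * (v 0 ⬝ᵥ star (v 1) - v 1 ⬝ᵥ star (v 0)) := by
  simp [Omega0, wedge_apply, Matrix.det_fin_two, dz, conjForm, dotProduct, Fin.sum_univ_three]
  ring

theorem Omega0_mulVec (a : SU3) (v : Fin 2 → Fin 3 → ℂ) :
    Omega0 (fun i => (a : Matrix (Fin 3) (Fin 3) ℂ) *ᵥ v i) = Omega0 v := by
  have h : (a : Matrix (Fin 3) (Fin 3) ℂ)ᴴ * (a : Matrix (Fin 3) (Fin 3) ℂ) = 1 :=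
    (Matrix.mem_unitaryGroup_iff').1 (Matrix.mem_specialUnitaryGroup_iff.1 a.2).1
  have key : ∀ x y : Fin 3 → ℂ, ((a : Matrix (Fin 3) (Fin 3) ℂ) *ᵥ x) ⬝ᵥ
      star ((a : Matrix (Fin 3) (Fin 3) ℂ) *ᵥ y) = x ⬝ᵥ star y := by
    intro x y
    rw [Matrix.star_mulVec, dotProduct_comm, ← Matrix.dotProduct_mulVec, Matrix.mulVec_mulVec, h,
      Matrix.one_mulVec, dotProduct_comm]
  rw [Omega0_apply, Omega0_apply, key, key]

theorem Psi0_mulVec (a : SU3) (v : Fin 3 → Fin 3 → ℂ) :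
    Psi0 (fun i => (a : Matrix (Fin 3) (Fin 3) ℂ) *ᵥ v i) = Psi0 v := by
  have e : (Matrix.of fun i j => dz i ((a : Matrix (Fin 3) (Fin 3) ℂ) *ᵥ v j)) =
      (a : Matrix (Fin 3) (Fin 3) ℂ) * Matrix.of fun i j => dz i (v j) := by
    ext i j
    rfl
  rw [Psi0, wedge_apply, wedge_apply, e, Matrix.det_mul,
    (Matrix.mem_specialUnitaryGroup_iff.1 a.2).2, one_mul]

/-! ### `SU(3)`-structures -/

/-- A smooth `SU(3)`-structure `π : P → M` on a 6-manifold `M`.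

`P` is a (14-dimensional) principal right `SU(3)`-bundle over `M` whose points `p` over `x` are
realized as coframes, that is linear isomorphisms `coframe p : T_x M → ℂ³`, with right action
`u · a = a⁻¹ ∘ u`. Since the action is simply transitive on the fibres, `p ↦ (π p, coframe p)`
identifies `P` with an `SU(3)`-subbundle of the bundle of coframes of `M`. -/
structure SU3Structure
    (M : Type*) [TopologicalSpace M] [ChartedSpace (EuclideanSpace ℝ (Fin 6)) M]
    [IsManifold (𝓡 6) ∞ M]
    (P : Type*) [TopologicalSpace P] [ChartedSpace (EuclideanSpace ℝ (Fin 14)) P]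
    [IsManifold (𝓡 14) ∞ P] where
  /-- the bundle projection `π` -/
  proj : P → M
  contMDiff_proj : ContMDiff (𝓡 14) (𝓡 6) ∞ proj
  /-- there are smooth local sections through every fibre -/
  exists_section : ∀ x : M, ∃ U : Set M, IsOpen U ∧ x ∈ U ∧ ∃ s : M → P,
    ContMDiffOn (𝓡 6) (𝓡 14) ∞ s U ∧ ∀ y ∈ U, proj (s y) = y
  /-- the right action of `SU(3)` on `P` -/
  act : P → SU3 → P
  act_one : ∀ p, act p 1 = p
  act_mul : ∀ p a b, act p (a * b) = act (act p a) b
  /-- The action `P × SU(3) → P` is smooth, where `SU(3)` is a submanifold of the space of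
  `3 × 3` complex matrices: composing it with smooth maps (from open subsets of Euclidean spaces)
  into `P` and into `SU(3)` gives smooth maps. -/
  contMDiff_act : ∀ (n : ℕ) (W : Set (EuclideanSpace ℝ (Fin n))), IsOpen W →
    ∀ (f : EuclideanSpace ℝ (Fin n) → P) (g : EuclideanSpace ℝ (Fin n) → SU3),
    ContMDiffOn (𝓡 n) (𝓡 14) ∞ f W →
    (∀ i j, ContDiffOn ℝ ∞ (fun z => (g z : Matrix (Fin 3) (Fin 3) ℂ) i j) W) →
    ContMDiffOn (𝓡 n) (𝓡 14) ∞ (fun z => act (f z) (g z)) W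
  proj_act : ∀ p a, proj (act p a) = proj p
  /-- the action is transitive on the fibres (that it is free follows from `coframe_act`) -/
  exists_act_eq : ∀ p q, proj p = proj q → ∃ a, act p a = q
  /-- the coframe at `π p` given by the point `p` of `P` -/
  coframe : ∀ p : P, TangentSpace (𝓡 6) (proj p) ≃L[ℝ] (Fin 3 → ℂ)
  /-- `p ↦ (π p, coframe p)` is a smooth map into the bundle `Hom(TM, ℂ³)` -/
  contMDiff_coframe :
    ContMDiff (𝓡 14) ((𝓡 6).prod 𝓘(ℝ, EuclideanSpace ℝ (Fin 6) →L[ℝ] (Fin 3 → ℂ))) ∞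
      (fun p => (⟨proj p, (coframe p : TangentSpace (𝓡 6) (proj p) →L[ℝ] (Fin 3 → ℂ))⟩ :
        Bundle.TotalSpace (EuclideanSpace ℝ (Fin 6) →L[ℝ] (Fin 3 → ℂ))
          (fun x : M => TangentSpace (𝓡 6) x →L[ℝ] Bundle.Trivial M (Fin 3 → ℂ) x)))
  /-- `u · a = a⁻¹ ∘ u`; here `v` is tangent to `M` at `π (p · a) = π p`, and the two tangent
  spaces at that point are the same copy of the model space. -/
  coframe_act : ∀ (p : P) (a : SU3) (v : EuclideanSpace ℝ (Fin 6)),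
    (coframe (act p a) : EuclideanSpace ℝ (Fin 6) → (Fin 3 → ℂ)) v =
      ((a⁻¹ : SU3) : Matrix (Fin 3) (Fin 3) ℂ) *ᵥ
        (coframe p : EuclideanSpace ℝ (Fin 6) → (Fin 3 → ℂ)) v

namespace SU3Structure

variable {M : Type*} [TopologicalSpace M] [ChartedSpace (EuclideanSpace ℝ (Fin 6)) M]
  [IsManifold (𝓡 6) ∞ M]
  {P : Type*} [TopologicalSpace P] [ChartedSpace (EuclideanSpace ℝ (Fin 14)) P]
  [IsManifold (𝓡 14) ∞ P]

theorem exists_proj_eq (S : SU3Structure M P) (x : M) : ∃ p : P, S.proj p = x := by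
  obtain ⟨U, -, hx, s, -, hs⟩ := S.exists_section x
  exact ⟨s x, hs x hx⟩

/-- Some coframe of the structure at `x`. -/
def someCoframe (S : SU3Structure M P) (x : M) :
    TangentSpace (𝓡 6) x ≃L[ℝ] (Fin 3 → ℂ) :=
  (S.exists_proj_eq x).choose_spec ▸ S.coframe (S.exists_proj_eq x).choose

/-- The 2-form of the structure: `Ω_x = u^* Ω₀` for any coframe `u ∈ P_x`. -/
def Omega (S : SU3Structure M P) (x : M) : TangentSpace (𝓡 6) x [⋀^Fin 2]→L[ℝ] ℂ :=
  Omega0.compContinuousLinearMap (S.someCoframe x : TangentSpace (𝓡 6) x →L[ℝ] (Fin 3 → ℂ))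

/-- The complex 3-form of the structure: `Ψ_x = u^* Ψ₀` for any coframe `u ∈ P_x`. -/
def Psi (S : SU3Structure M P) (x : M) : TangentSpace (𝓡 6) x [⋀^Fin 3]→L[ℝ] ℂ :=
  Psi0.compContinuousLinearMap (S.someCoframe x : TangentSpace (𝓡 6) x →L[ℝ] (Fin 3 → ℂ))

theorem coframe_eq_of_proj_eq (S : SU3Structure M P) (p q : P) (h : S.proj p = S.proj q) :
    ∃ a : SU3, ∀ v : EuclideanSpace ℝ (Fin 6),
      (S.coframe q : EuclideanSpace ℝ (Fin 6) → (Fin 3 → ℂ)) v =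
        (a : Matrix (Fin 3) (Fin 3) ℂ) *ᵥ
          (S.coframe p : EuclideanSpace ℝ (Fin 6) → (Fin 3 → ℂ)) v := by
  obtain ⟨a, rfl⟩ := S.exists_act_eq p q h
  exact ⟨a⁻¹, fun v => S.coframe_act p a v⟩

theorem someCoframe_eq (S : SU3Structure M P) (p : P) :
    ∃ a : SU3, ∀ v : TangentSpace (𝓡 6) (S.proj p),
      S.someCoframe (S.proj p) v = (a : Matrix (Fin 3) (Fin 3) ℂ) *ᵥ S.coframe p v := by
  have key : ∀ (x : M) (q : P) (h : S.proj q = x) (p : P), S.proj p = x →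
      ∃ a : SU3, ∀ v : EuclideanSpace ℝ (Fin 6),
        ((h ▸ S.coframe q : TangentSpace (𝓡 6) x ≃L[ℝ] (Fin 3 → ℂ)) :
          EuclideanSpace ℝ (Fin 6) → (Fin 3 → ℂ)) v =
        (a : Matrix (Fin 3) (Fin 3) ℂ) *ᵥ
          (S.coframe p : EuclideanSpace ℝ (Fin 6) → (Fin 3 → ℂ)) v := by
    rintro x q rfl p hp
    exact S.coframe_eq_of_proj_eq p q hp
  exact key (S.proj p) _ (S.exists_proj_eq (S.proj p)).choose_spec p rfl

/-- `Ω` does not depend on the chosen coframes. -/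
theorem Omega_proj (S : SU3Structure M P) (p : P) :
    S.Omega (S.proj p) = Omega0.compContinuousLinearMap
      (S.coframe p : TangentSpace (𝓡 6) (S.proj p) →L[ℝ] (Fin 3 → ℂ)) := by
  obtain ⟨a, ha⟩ := S.someCoframe_eq p
  ext v
  have e : (⇑(S.someCoframe (S.proj p)) ∘ v) =
      fun i => (a : Matrix (Fin 3) (Fin 3) ℂ) *ᵥ (S.coframe p (v i)) := funext fun i => ha (v i)
  change Omega0 (⇑(S.someCoframe (S.proj p)) ∘ v) = Omega0 (⇑(S.coframe p) ∘ v)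
  rw [e, Omega0_mulVec]
  rfl

/-- `Ψ` does not depend on the chosen coframes. -/
theorem Psi_proj (S : SU3Structure M P) (p : P) :
    S.Psi (S.proj p) = Psi0.compContinuousLinearMap
      (S.coframe p : TangentSpace (𝓡 6) (S.proj p) →L[ℝ] (Fin 3 → ℂ)) := by
  obtain ⟨a, ha⟩ := S.someCoframe_eq p
  ext v
  have e : (⇑(S.someCoframe (S.proj p)) ∘ v) =
      fun i => (a : Matrix (Fin 3) (Fin 3) ℂ) *ᵥ (S.coframe p (v i)) := funext fun i => ha (v i)
  change Psi0 (⇑(S.someCoframe (S.proj p)) ∘ v) = Psi0 (⇑(S.coframe p) ∘ v)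
  rw [e, Psi0_mulVec]
  rfl

/-- The real 3-form `Im Ψ`. -/
def imPsi (S : SU3Structure M P) (x : M) : TangentSpace (𝓡 6) x [⋀^Fin 3]→L[ℝ] ℝ :=
  Complex.imCLM.compContinuousAlternatingMap (S.Psi x)

/-- The structure is nearly Calabi-Yau: `dΩ = 0` and `d (Im Ψ) = 0`. -/
def IsNearlyCalabiYau (S : SU3Structure M P) : Prop :=
  (∀ x : M, mextDeriv S.Omega x = 0) ∧ (∀ x : M, mextDeriv S.imPsi x = 0)

/-- The components `ωᵢ` of the tautological `ℂ³`-valued 1-form on `P`: `ω_u(X) = u (π_* X)`. -/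
def tautForm (S : SU3Structure M P) (i : Fin 3) (p : P) : TangentSpace (𝓡 14) p →L[ℝ] ℂ :=
  ((dz i).comp (S.coframe p : TangentSpace (𝓡 6) (S.proj p) →L[ℝ] (Fin 3 → ℂ))).comp
    (mfderiv (𝓡 14) (𝓡 6) S.proj p)

/-- The matrix `α_p(v)` of the values of a matrix of 1-forms. -/
def formMatrix (α : Fin 3 → Fin 3 → ∀ p : P, TangentSpace (𝓡 14) p →L[ℝ] ℂ) (p : P)
    (v : TangentSpace (𝓡 14) p) : Matrix (Fin 3) (Fin 3) ℂ :=
  Matrix.of fun i j => α i j p v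

/-- `α = (α_{i j̄})` is a connection form on the principal `SU(3)`-bundle `P`: a smooth
`su(3)`-valued 1-form which restricts to the Maurer-Cartan form on the fibres and satisfies
`R_a^* α = a⁻¹ α a`. -/
structure IsConnection (S : SU3Structure M P)
    (α : Fin 3 → Fin 3 → ∀ p : P, TangentSpace (𝓡 14) p →L[ℝ] ℂ) : Prop where
  smooth : ∀ i j, IsSmoothOneForm (α i j)
  skewHermitian : ∀ p v, (formMatrix α p v)ᴴ = -formMatrix α p v
  trace_zero : ∀ p v, (formMatrix α p v).trace = 0
  /-- for a smooth curve `g` in `SU(3)` with `g 0 = 1`, the value of `α` on the velocity at `t = 0`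
  of the vertical curve `t ↦ p · g t` is the element `g' 0` of `su(3)` -/
  vertical : ∀ (p : P) (g : ℝ → SU3), g 0 = 1 →
    (∀ i j, ContDiff ℝ ∞ (fun t => (g t : Matrix (Fin 3) (Fin 3) ℂ) i j)) →
    ∀ i j, α i j (S.act p (g 0))
        (mfderiv 𝓘(ℝ, ℝ) (𝓡 14) (fun t : ℝ => S.act p (g t)) 0 (1 : ℝ)) =
      deriv (fun t => (g t : Matrix (Fin 3) (Fin 3) ℂ) i j) 0
  equivariant : ∀ (a : SU3) (p : P) (v : TangentSpace (𝓡 14) p),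
    formMatrix α (S.act p a) (mfderiv (𝓡 14) (𝓡 14) (fun q => S.act q a) p v) =
      ((a⁻¹ : SU3) : Matrix (Fin 3) (Fin 3) ℂ) * formMatrix α p v *
        (a : Matrix (Fin 3) (Fin 3) ℂ)

/-- The structure equations on `P` with torsion `N = (N_{i j̄})` only:
`dωᵢ = - α_{i j̄} ∧ ωⱼ + ½ N_{i j̄} ε_{jkl} ω̄ₖ ∧ ω̄ₗ`, summed over repeated indices. -/
def StructureEquations (S : SU3Structure M P)
    (α : Fin 3 → Fin 3 → ∀ p : P, TangentSpace (𝓡 14) p →L[ℝ] ℂ)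
    (N : P → Matrix (Fin 3) (Fin 3) ℂ) : Prop :=
  ∀ (p : P) (i : Fin 3),
    mextDeriv (oneForm (S.tautForm i)) p =
      -(∑ j, wedge ![α i j p, S.tautForm j p]) +
        (1 / 2 : ℂ) • ∑ j, ∑ k, ∑ l, (N p i j * epsilon j k l) •
          wedge ![conjForm (S.tautForm k p), conjForm (S.tautForm l p)]

/-- `α` is a connection on `P` whose structure equations have only the torsion `N`, which is
Hermitian symmetric and trace-free. -/
def IsNearlyCalabiYauConnection (S : SU3Structure M P)
    (α : Fin 3 → Fin 3 → ∀ p : P, TangentSpace (𝓡 14) p →L[ℝ] ℂ) : Prop :=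
  S.IsConnection α ∧ ∃ N : P → Matrix (Fin 3) (Fin 3) ℂ,
    S.StructureEquations α N ∧ ∀ p, (N p).IsHermitian ∧ (N p).trace = 0

end SU3Structure

end

/-!
Let `ω` be the tautological form. The forms `π^* Ω` and `π^* (Im Ψ)` are `Ω₀ (ω, ω)` and
`Im Ψ₀ (ω, ω, ω)`, so that, as `π` is a submersion, the structure is nearly Calabi-Yau if and only
if two algebraic conditions on `dω` hold: with `Θᵢ = ½ ε_{ijk} ωⱼ ∧ ωₖ`, the forms
`∑ dωᵢ ∧ ω̄ᵢ` and `∑ dωᵢ ∧ Θᵢ` are real (`isNearlyCalabiYau_iff`).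
A term `K ∧ ω` with values of `K` in `𝔰𝔲(3)` contributes to neither condition
(`hermWedge_matWedge_im`, `volWedge_matWedge`), and a term `N (ω̄ × ω̄)` contributes to neither if
`N` is Hermitian and trace-free (`hermWedge_torsionTerm`, `volWedge_torsionTerm_im`). So a
connection as in the theorem forces the structure to be nearly Calabi-Yau.

Conversely, let `τ` be a `ℂ³`-valued 2-form on `ℂ³` which satisfies the two conditions. There is one
skew-Hermitian matrix valued 1-form `A` for which `τ + A ∧ z` has no component of type `(1, 1)`
(`torsionConn`). The reality of `∑ τᵢ ∧ z̄ᵢ` then kills the component of type `(2, 0)`, so that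
`τ + A ∧ z = N (z̄ × z̄)` for some matrix `N`, and it gives `tr N = 0`; the other condition gives
`tr A = 0` and that `N` is Hermitian (`exists_torsion`). Conversely `A` is determined by `τ`
(`eq_of_matWedge_add_torsionTerm`): if `A ∧ z` is of type `(0, 2)`, then `A` is complex linear, and
a complex linear form with skew-Hermitian values vanishes. This is the uniqueness of the connection.

For the existence of the connection, a local section `σ` of `P`, regarded as a coframe field `η` on
`M`, identifies `ω` with `h η`, where `h` is a function on `P` with values in `SU(3)`, and
`dω = (dh h⁻¹) ∧ ω + h dη` (`dtaut_eq`). The pointwise result applied to `dη` gives a form `β` on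
`M`, and `- dh h⁻¹ + h β h⁻¹` is a smooth connection form over the domain of `σ`
(`localConn_structure`, `contDiffAt_localConn`, `localConn_dact`, `localConn_vertical`). By
uniqueness these forms agree on overlaps (`localConn_eq_localConn`), so they define a connection on
`P`.
-/

noncomputable section

/-! ### Linear algebra of the torsion on `ℂ³` -/

/-- The complex volume `det (x, y, z)` of three vectors of `ℂ³`, that is `Ψ₀ (x, y, z)`. -/
def vol (x y z : Fin 3 → ℂ) : ℂ := x ⬝ᵥ y ⨯₃ z

theorem vol_eq (x y z : Fin 3 → ℂ) : vol x y z =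
    x 0 * (y 1 * z 2 - y 2 * z 1) + x 1 * (y 2 * z 0 - y 0 * z 2)
      + x 2 * (y 0 * z 1 - y 1 * z 0) := by
  simp only [vol, cross_apply, dotProduct, Fin.sum_univ_three, Matrix.cons_val]

theorem Psi0_eq_vol (v : Fin 3 → Fin 3 → ℂ) : Psi0 v = vol (v 0) (v 1) (v 2) := by
  rw [Psi0, wedge_apply, vol_eq, Matrix.det_fin_three]
  simp only [Matrix.of_apply, dz, ContinuousLinearMap.proj_apply]
  ring

theorem Omega0_eq_im (v : Fin 2 → Fin 3 → ℂ) :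
    Omega0 v = ((-(v 0 ⬝ᵥ star (v 1)).im : ℝ) : ℂ) := by
  have h : v 1 ⬝ᵥ star (v 0) = star (v 0 ⬝ᵥ star (v 1)) := by
    rw [← Matrix.star_dotProduct_star, star_star, dotProduct_comm]
  rw [Omega0_apply, h]
  apply Complex.ext <;> simp
  ring

theorem mulVec_dotProduct_star (A : Matrix (Fin 3) (Fin 3) ℂ) (x y : Fin 3 → ℂ) :
    (A *ᵥ x) ⬝ᵥ star y = star ((Aᴴ *ᵥ y) ⬝ᵥ star x) := by
  simp only [Matrix.mulVec, dotProduct, Fin.sum_univ_three, Pi.star_apply, star_add, star_mul',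
    star_star, Matrix.conjTranspose_apply]
  ring

theorem star_cross_star (x y : Fin 3 → ℂ) : star x ⨯₃ star y = star (x ⨯₃ y) := by
  ext i
  fin_cases i <;> simp [cross_apply]

section Forms

variable {V : Type*}

/-- The complex 3-form `∑ᵢ τᵢ ∧ θ̄ᵢ` for a `ℂ³`-valued 2-form `τ` and a `ℂ³`-valued 1-form `θ`.
For `τ = dθ` its imaginary part is, up to sign, the exterior derivative of `Ω₀ (θ, θ)`. -/
def hermWedge (τ : V → V → Fin 3 → ℂ) (θ : V → Fin 3 → ℂ) (u v w : V) : ℂ :=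
  τ u v ⬝ᵥ star (θ w) + τ v w ⬝ᵥ star (θ u) + τ w u ⬝ᵥ star (θ v)

/-- The complex 4-form `∑ᵢ τᵢ ∧ (½ ∑ⱼₖ ε_{ijk} θⱼ ∧ θₖ)`, the sum of `± det (τ, θ, θ)` over the
`(2, 2)`-shuffles. For `τ = dθ` it is the exterior derivative of `Ψ₀ (θ, θ, θ)`. -/
def volWedge (τ : V → V → Fin 3 → ℂ) (θ : V → Fin 3 → ℂ) (u v w z : V) : ℂ :=
  vol (τ u v) (θ w) (θ z) - vol (τ u w) (θ v) (θ z) + vol (τ u z) (θ v) (θ w)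
    + vol (τ v w) (θ u) (θ z) - vol (τ v z) (θ u) (θ w) + vol (τ w z) (θ u) (θ v)

/-- The `ℂ³`-valued 2-form `(K ∧ θ) (u, v) = K (u) θ (v) - K (v) θ (u)`. -/
def matWedge (K : V → Matrix (Fin 3) (Fin 3) ℂ) (θ : V → Fin 3 → ℂ) (u v : V) : Fin 3 → ℂ :=
  K u *ᵥ θ v - K v *ᵥ θ u

/-- The torsion term `N (θ̄ × θ̄)`, where `(θ̄ × θ̄) (u, v)` is the cross product of `θ̄ (u)` and
`θ̄ (v)`; its `i`-th component is `½ N_{ij} ε_{jkl} θ̄ₖ ∧ θ̄ₗ`. -/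
def torsionTerm (N : Matrix (Fin 3) (Fin 3) ℂ) (θ : V → Fin 3 → ℂ) (u v : V) : Fin 3 → ℂ :=
  N *ᵥ (star (θ u) ⨯₃ star (θ v))

theorem hermWedge_matWedge_im {K : V → Matrix (Fin 3) (Fin 3) ℂ} (hK : ∀ v, (K v)ᴴ = -K v)
    (θ : V → Fin 3 → ℂ) (u v w : V) : (hermWedge (matWedge K θ) θ u v w).im = 0 := by
  have key : ∀ (u : V) (x y : Fin 3 → ℂ),
      ((K u *ᵥ x) ⬝ᵥ star y).im = ((K u *ᵥ y) ⬝ᵥ star x).im := by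
    intro u x y
    rw [mulVec_dotProduct_star, hK, Matrix.neg_mulVec]
    simp
  simp only [hermWedge, matWedge, sub_dotProduct, Complex.add_im, Complex.sub_im]
  rw [key u (θ v), key v (θ w), key w (θ u)]
  ring

theorem vol_trace (A : Matrix (Fin 3) (Fin 3) ℂ) (x y z : Fin 3 → ℂ) :
    vol (A *ᵥ x) y z + vol x (A *ᵥ y) z + vol x y (A *ᵥ z) = A.trace * vol x y z := by
  simp only [vol_eq, Matrix.mulVec, dotProduct, Fin.sum_univ_three, Matrix.trace, Matrix.diag_apply]
  ring

theorem volWedge_matWedge (K : V → Matrix (Fin 3) (Fin 3) ℂ) (θ : V → Fin 3 → ℂ) (u v w z : V) :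
    volWedge (matWedge K θ) θ u v w z =
      (K u).trace * vol (θ v) (θ w) (θ z) - (K v).trace * vol (θ u) (θ w) (θ z)
        + (K w).trace * vol (θ u) (θ v) (θ z) - (K z).trace * vol (θ u) (θ v) (θ w) := by
  simp only [volWedge, matWedge, ← vol_trace]
  simp only [vol_eq, Pi.sub_apply]
  ring

theorem hermWedge_torsionTerm (N : Matrix (Fin 3) (Fin 3) ℂ) (θ : V → Fin 3 → ℂ) (u v w : V) :
    hermWedge (torsionTerm N θ) θ u v w =
      N.trace * vol (star (θ u)) (star (θ v)) (star (θ w)) := by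
  simp only [hermWedge, torsionTerm, vol_eq, cross_apply, Matrix.mulVec, dotProduct,
    Fin.sum_univ_three, Matrix.trace, Matrix.diag_apply, Pi.star_apply, Matrix.cons_val]
  ring

/-- The 4-form `∑ N_{ij} Θ̄ⱼ ∧ Θᵢ`, with `Θ = ½ ε θ ∧ θ`, is real for Hermitian `N`. -/
theorem volWedge_torsionTerm_im {N : Matrix (Fin 3) (Fin 3) ℂ} (hN : N.IsHermitian)
    (θ : V → Fin 3 → ℂ) (u v w z : V) : (volWedge (torsionTerm N θ) θ u v w z).im = 0 := by
  have key : ∀ a b c d : V, vol (torsionTerm N θ a b) (θ c) (θ d) =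
      star (vol (torsionTerm N θ c d) (θ a) (θ b)) := by
    intro a b c d
    simp only [vol, torsionTerm, star_cross_star]
    have h := mulVec_dotProduct_star N (star (θ a ⨯₃ θ b)) (star (θ c ⨯₃ θ d))
    rwa [hN.eq, star_star, star_star] at h
  simp only [volWedge, Complex.add_im, Complex.sub_im]
  rw [key u v, key u w, key u z]
  simp

theorem volWedge_add (τ τ' : V → V → Fin 3 → ℂ) (θ : V → Fin 3 → ℂ) (u v w z : V) :
    volWedge (fun a b => τ a b + τ' a b) θ u v w z =
      volWedge τ θ u v w z + volWedge τ' θ u v w z := by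
  simp only [volWedge, vol, add_dotProduct]
  ring

theorem hermWedge_add (τ τ' : V → V → Fin 3 → ℂ) (θ : V → Fin 3 → ℂ) (u v w : V) :
    hermWedge (fun a b => τ a b + τ' a b) θ u v w =
      hermWedge τ θ u v w + hermWedge τ' θ u v w := by
  simp only [hermWedge, add_dotProduct]
  ring

end Forms

/-! ### Absorption of the torsion at a point -/

theorem sum_smul_single_of_map_I_smul (g : (Fin 3 → ℂ) →ₗ[ℝ] (Fin 3 → ℂ)) (c : ℂ)
    (hg : ∀ u, g (Complex.I • u) = c • g u) (u : Fin 3 → ℂ) :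
    g u = ∑ j, (((u j).re : ℂ) + (u j).im * c) • g (Pi.single j 1) := by
  have hu : u = ∑ j, ((u j).re • (Pi.single j 1 : Fin 3 → ℂ)
      + (u j).im • (Complex.I • (Pi.single j 1 : Fin 3 → ℂ))) := by
    ext i
    simp [Finset.sum_apply, Pi.single_apply, Finset.sum_add_distrib]
  conv_lhs => rw [hu]
  simp only [map_sum, map_add, map_smul, hg, add_smul, mul_smul, Complex.coe_smul]

/-- The matrix of `v ↦ b (v, w)`, where `b (v, w)` is the part of `τ (v, w)` which is complex
linear in `v` and conjugate linear in `w`. -/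
def mixedPart (τ : (Fin 3 → ℂ) → (Fin 3 → ℂ) → Fin 3 → ℂ) (w : Fin 3 → ℂ) :
    Matrix (Fin 3) (Fin 3) ℂ :=
  Matrix.of fun i j => (1 / 4 : ℂ) *
    (τ (Pi.single j 1) w i - Complex.I * τ (Complex.I • Pi.single j 1) w i
      + Complex.I * τ (Pi.single j 1) (Complex.I • w) i
      + τ (Complex.I • Pi.single j 1) (Complex.I • w) i)

/-- The skew-Hermitian matrix valued form `A = B - Bᴴ` whose conjugate linear part is
`B = mixedPart τ`. It is the only one for which `τ + A ∧ z` has no component of type `(1, 1)`. -/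
def torsionConn (τ : (Fin 3 → ℂ) → (Fin 3 → ℂ) → Fin 3 → ℂ) (w : Fin 3 → ℂ) :
    Matrix (Fin 3) (Fin 3) ℂ :=
  mixedPart τ w - (mixedPart τ w)ᴴ

theorem torsionConn_conjTranspose (τ : (Fin 3 → ℂ) → (Fin 3 → ℂ) → Fin 3 → ℂ) (w : Fin 3 → ℂ) :
    (torsionConn τ w)ᴴ = -torsionConn τ w := by
  simp [torsionConn]

section Torsion

variable (τ : (Fin 3 → ℂ) →ₗ[ℝ] (Fin 3 → ℂ) →ₗ[ℝ] (Fin 3 → ℂ))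

theorem mixedPart_mulVec (v w : Fin 3 → ℂ) :
    mixedPart (fun a b => τ a b) w *ᵥ v = (1 / 4 : ℂ) •
      (τ v w - Complex.I • τ (Complex.I • v) w + Complex.I • τ v (Complex.I • w)
        + τ (Complex.I • v) (Complex.I • w)) := by
  -- the right hand side is complex linear in `v`, hence determined on the standard basis
  let J : (Fin 3 → ℂ) →ₗ[ℝ] (Fin 3 → ℂ) :=
    (LinearMap.lsmul ℂ (Fin 3 → ℂ) Complex.I).restrictScalars ℝ
  let g : (Fin 3 → ℂ) →ₗ[ℝ] (Fin 3 → ℂ) :=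
    (LinearMap.lsmul ℂ (Fin 3 → ℂ) (1 / 4 : ℂ)).restrictScalars ℝ ∘ₗ
      (τ.flip w - J ∘ₗ τ.flip w ∘ₗ J + J ∘ₗ τ.flip (Complex.I • w) + τ.flip (Complex.I • w) ∘ₗ J)
  have hg : ∀ v, g v = (1 / 4 : ℂ) •
      (τ v w - Complex.I • τ (Complex.I • v) w + Complex.I • τ v (Complex.I • w)
        + τ (Complex.I • v) (Complex.I • w)) := fun v => rfl
  have hI : ∀ v : Fin 3 → ℂ, Complex.I • Complex.I • v = -v := by
    intro v; rw [smul_smul]; simp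
  rw [← hg, sum_smul_single_of_map_I_smul g Complex.I]
  · simp only [Complex.re_add_im, hg]
    ext i
    simp only [mixedPart, Matrix.mulVec, dotProduct, Matrix.of_apply, Finset.sum_apply,
      Pi.smul_apply, Pi.add_apply, Pi.sub_apply, smul_eq_mul]
    exact Finset.sum_congr rfl fun j _ => by ring
  · intro v
    simp only [hg, hI, map_neg, LinearMap.neg_apply]
    ext i
    simp only [Pi.smul_apply, Pi.add_apply, Pi.sub_apply, Pi.neg_apply, smul_eq_mul]
    linear_combination (1 / 4 : ℂ) * (τ (Complex.I • v) w i - τ v (Complex.I • w) i) * Complex.I_sq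

theorem mixedPart_I_smul (w : Fin 3 → ℂ) :
    mixedPart (fun a b => τ a b) (Complex.I • w) = -Complex.I • mixedPart (fun a b => τ a b) w := by
  ext i j
  have hI : Complex.I • Complex.I • w = -w := by rw [smul_smul]; simp
  simp only [mixedPart, Matrix.of_apply, Matrix.smul_apply, hI, map_neg, Pi.neg_apply, smul_eq_mul]
  linear_combination (1 / 4 : ℂ) * (τ (Pi.single j 1) (Complex.I • w) i
    - τ (Complex.I • Pi.single j 1) w i) * Complex.I_sq

theorem torsionConn_add (u v : Fin 3 → ℂ) : torsionConn (fun a b => τ a b) (u + v) =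
    torsionConn (fun a b => τ a b) u + torsionConn (fun a b => τ a b) v := by
  have hB : mixedPart (fun a b => τ a b) (u + v) =
      mixedPart (fun a b => τ a b) u + mixedPart (fun a b => τ a b) v := by
    ext i j
    simp only [mixedPart, Matrix.of_apply, Matrix.add_apply, map_add, smul_add, Pi.add_apply]
    ring
  simp only [torsionConn, hB, Matrix.conjTranspose_add]
  abel

theorem torsionConn_smul (c : ℝ) (u : Fin 3 → ℂ) : torsionConn (fun a b => τ a b) (c • u) =
    c • torsionConn (fun a b => τ a b) u := by
  have hB : mixedPart (fun a b => τ a b) (c • u) = c • mixedPart (fun a b => τ a b) u := by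
    ext i j
    simp only [mixedPart, Matrix.of_apply, Matrix.smul_apply, map_smul, smul_comm Complex.I c,
      Pi.smul_apply, Complex.real_smul]
    ring
  simp only [torsionConn, hB, Matrix.conjTranspose_smul, star_trivial, smul_sub]

/-- Suppose that `T` has components of type `(2, 0)` and `(0, 2)` only. If `∑ᵢ Tᵢ ∧ z̄ᵢ` is real,
then `T` is of type `(0, 2)`, because the `(2, 1)`-component of `∑ᵢ Tᵢ ∧ z̄ᵢ` is conjugate to its
vanishing `(1, 2)`-component; likewise the `(0, 3)`-component vanishes. -/
theorem map_I_smul_of_hermWedge_im {T : (Fin 3 → ℂ) →ₗ[ℝ] (Fin 3 → ℂ) →ₗ[ℝ] (Fin 3 → ℂ)}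
    (hT : ∀ u v, T (Complex.I • u) (Complex.I • v) = -T u v)
    (h1 : ∀ u v w, (hermWedge (fun a b => T a b) id u v w).im = 0) (u v w : Fin 3 → ℂ) :
    T (Complex.I • u) v = -Complex.I • T u v ∧
      hermWedge (fun a b => T a b) id u v w = 0 := by
  have hI : ∀ v : Fin 3 → ℂ, Complex.I • Complex.I • v = -v := by
    intro v; rw [smul_smul]; simp
  have hT' : ∀ u v, T u (Complex.I • v) = T (Complex.I • u) v := by
    intro u v
    have := hT (Complex.I • u) v
    rw [hI, map_neg, LinearMap.neg_apply] at this
    exact neg_injective this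
  have hz : ∀ z : Fin 3 → ℂ, star (Complex.I • z) = -(Complex.I • star z) := by
    intro z; simp [star_smul]
  have key : ∀ u v w, (T (Complex.I • u) v ⬝ᵥ star w = -Complex.I * (T u v ⬝ᵥ star w)) ∧
      hermWedge (fun a b => T a b) id u v w = 0 := by
    intro u v w
    have e0 := h1 u v w
    have e1 := h1 (Complex.I • u) v w
    have e2 := h1 u (Complex.I • v) w
    have e3 := h1 u v (Complex.I • w)
    have e4 := h1 (Complex.I • u) (Complex.I • v) w
    have e5 := h1 (Complex.I • u) v (Complex.I • w)
    have e6 := h1 u (Complex.I • v) (Complex.I • w)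
    have e7 := h1 (Complex.I • u) (Complex.I • v) (Complex.I • w)
    simp only [hermWedge, id, hT, hT', hz, neg_dotProduct, dotProduct_neg,
      dotProduct_smul, smul_eq_mul, neg_neg, Complex.add_im, Complex.mul_im, Complex.I_re,
      Complex.I_im, Complex.neg_im, Complex.neg_re, zero_mul, one_mul,
      zero_add] at e0 e1 e2 e3 e4 e5 e6 e7
    -- the types are separated by multiplying the arguments by `i` in all possible ways
    constructor
    · apply Complex.ext <;> simp <;> linarith
    · apply Complex.ext <;> simp [hermWedge] <;> linarith
  refine ⟨?_, (key u v w).2⟩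
  ext i
  have := (key u v (Pi.single i 1)).1
  have hs : star (Pi.single i 1 : Fin 3 → ℂ) = Pi.single i 1 := by
    ext j; by_cases h : j = i <;> simp [h]
  rw [hs] at this
  simpa using this

/-- Forms of type `(0, 2)` are spanned by the products `z̄ₖ ∧ z̄ₗ`. -/
theorem eq_torsionTerm {T : (Fin 3 → ℂ) →ₗ[ℝ] (Fin 3 → ℂ) →ₗ[ℝ] (Fin 3 → ℂ)}
    (halt : ∀ u, T u u = 0) (hT : ∀ u v, T (Complex.I • u) v = -Complex.I • T u v) :
    ∃ N : Matrix (Fin 3) (Fin 3) ℂ, ∀ u v, T u v = torsionTerm N id u v := by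
  have hskew : ∀ u v, T u v = -T v u := by
    intro u v
    have := halt (u + v)
    simp only [map_add, LinearMap.add_apply, halt, zero_add, add_zero] at this
    exact eq_neg_of_add_eq_zero_right this
  have hT' : ∀ u v, T u (Complex.I • v) = -Complex.I • T u v := by
    intro u v; rw [hskew, hT, hskew u v, smul_neg]
  refine ⟨Matrix.of fun i => ![T (Pi.single 1 1) (Pi.single 2 1) i,
    T (Pi.single 2 1) (Pi.single 0 1) i, T (Pi.single 0 1) (Pi.single 1 1) i], fun u v => ?_⟩
  have hc : ∀ z : ℂ, (z.re : ℂ) + z.im * -Complex.I = star z := by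
    intro z; apply Complex.ext <;> simp
  have e1 : ∀ v, T u v = ∑ j, star (u j) • T (Pi.single j 1) v := by
    intro v
    have := sum_smul_single_of_map_I_smul (T.flip v) (-Complex.I) (fun u => hT u v) u
    simpa only [hc, LinearMap.flip_apply] using this
  have e2 : ∀ u, T u v = ∑ j, star (v j) • T u (Pi.single j 1) := by
    intro u
    have := sum_smul_single_of_map_I_smul (T u) (-Complex.I) (fun v => hT' u v) v
    simpa only [hc] using this
  rw [e1]
  simp only [e2, Fin.sum_univ_three, halt, hskew (Pi.single 1 1) (Pi.single 0 1),
    hskew (Pi.single 2 1) (Pi.single 1 1), hskew (Pi.single 0 1) (Pi.single 2 1)]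
  ext i
  simp only [torsionTerm, Matrix.mulVec, dotProduct, Fin.sum_univ_three, Matrix.of_apply,
    Matrix.cons_val, cross_apply, id, Pi.star_apply, Pi.add_apply, Pi.smul_apply, smul_eq_mul,
    Pi.neg_apply, Pi.zero_apply]
  ring

/-- Let `T` be of type `(0, 2)` and let `a` have imaginary values. If the imaginary parts of
`½ ∑ T ∧ ε z ∧ z`, which is of type `(2, 2)`, and of `a ∧ Ψ₀`, which is of type `(3, 1)`, agree,
then `a` is complex linear by comparison of types, and hence vanishes. -/
theorem trace_eq_zero_of_volWedge_im {T : (Fin 3 → ℂ) →ₗ[ℝ] (Fin 3 → ℂ) →ₗ[ℝ] (Fin 3 → ℂ)}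
    {a : (Fin 3 → ℂ) →ₗ[ℝ] ℂ} (ha : ∀ u, (a u).re = 0)
    (halt : ∀ u, T u u = 0) (hT : ∀ u v, T (Complex.I • u) v = -Complex.I • T u v)
    (h : ∀ u v w z, (volWedge (fun a b => T a b) id u v w z).im =
      (a u * vol v w z - a v * vol u w z + a w * vol u v z - a z * vol u v w).im)
    (u : Fin 3 → ℂ) : a u = 0 := by
  have hskew : ∀ u v, T u v = -T v u := by
    intro u v
    have := halt (u + v)
    simp only [map_add, LinearMap.add_apply, halt, zero_add, add_zero] at this
    exact eq_neg_of_add_eq_zero_right this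
  have hT' : ∀ u v, T u (Complex.I • v) = -Complex.I • T u v := by
    intro u v; rw [hskew, hT, hskew u v, smul_neg]
  have hI : ∀ v : Fin 3 → ℂ, Complex.I • Complex.I • v = -v := by
    intro v; rw [smul_smul]; simp
  have hs1 : ∀ (c : ℂ) (x y z : Fin 3 → ℂ), vol (c • x) y z = c * vol x y z := by
    intro c x y z; simp [vol]
  have hs2 : ∀ (c : ℂ) (x y z : Fin 3 → ℂ), vol x (c • y) z = c * vol x y z := by
    intro c x y z; simp [vol]
  have hs3 : ∀ (c : ℂ) (x y z : Fin 3 → ℂ), vol x y (c • z) = c * vol x y z := by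
    intro c x y z; simp [vol]
  have hv : ∀ x y : Fin 3 → ℂ, vol x x y = 0 := by
    intro x y; simp only [vol_eq]; ring
  have hv' : ∀ x y : Fin 3 → ℂ, vol x y y = 0 := by
    intro x y; simp only [vol_eq]; ring
  have hv'' : ∀ x y : Fin 3 → ℂ, vol x y x = 0 := by
    intro x y; simp only [vol_eq]; ring
  have D : ∀ u v w, volWedge (fun a b => T a b) id (Complex.I • u) u v w =
      2 * Complex.I * (vol (T u v) u w - vol (T u w) u v) := by
    intro u v w
    simp only [volWedge, id, hT, halt, hs1, hs2, hv', smul_zero]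
    simp [vol]
    ring
  have E : ∀ u v w, (2 * Complex.I * (vol (T u v) u w - vol (T u w) u v)).im =
      ((a (Complex.I • u) - Complex.I * a u) * vol u v w).im := by
    intro u v w
    rw [← D, h]
    congr 1
    simp only [hs1, hv]
    ring
  have F : ∀ u v w, (((a (Complex.I • u) - Complex.I * a u) * vol u v w).im) = 0 := by
    intro u v w
    have e1 := E u v w
    -- rotating `v` and `w` by opposite quarter turns changes the sign of the left hand side only
    have e2 := E u (Complex.I • v) (-Complex.I • w)
    have hm : T u (-Complex.I • w) = Complex.I • T u w := by
      rw [neg_smul, map_neg, hT', neg_smul, neg_neg]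
    simp only [hT', hm, hs1, hs2, hs3] at e2
    have e3 : 2 * Complex.I * (-Complex.I * (-Complex.I * vol (T u v) u w)
        - Complex.I * (Complex.I * vol (T u w) u v)) =
      -(2 * Complex.I * (vol (T u v) u w - vol (T u w) u v)) := by
      linear_combination (2 * Complex.I * (vol (T u v) u w - vol (T u w) u v)) * Complex.I_sq
    have e4 : (a (Complex.I • u) - Complex.I * a u) * (-Complex.I * (Complex.I * vol u v w)) =
      (a (Complex.I • u) - Complex.I * a u) * vol u v w := by
      linear_combination (-(a (Complex.I • u) - Complex.I * a u) * vol u v w) * Complex.I_sq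
    have e5 : Complex.I * (-Complex.I * vol u v w) = -Complex.I * (Complex.I * vol u v w) := by ring
    rw [e3, e5, e4, Complex.neg_im] at e2
    linarith
  have G : ∀ u v w, vol u v w = 1 → a (Complex.I • u) = 0 ∧ a u = 0 := by
    intro u v w hvol
    have f1 := F u v w
    have f2 := F u v (Complex.I • w)
    rw [hs3, hvol] at f2
    rw [hvol] at f1
    have r1 := ha u
    have r2 := ha (Complex.I • u)
    simp at f1 f2
    constructor <;> apply Complex.ext <;> simp <;> linarith
  have hb : ∀ j : Fin 3, a (Complex.I • Pi.single j 1) = 0 ∧ a (Pi.single j 1) = 0 := by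
    intro j
    fin_cases j
    · exact G _ (Pi.single 1 1) (Pi.single 2 1) (by simp [vol_eq])
    · exact G _ (Pi.single 2 1) (Pi.single 0 1) (by simp [vol_eq])
    · exact G _ (Pi.single 0 1) (Pi.single 1 1) (by simp [vol_eq])
  have hu : u = ∑ j, ((u j).re • (Pi.single j 1 : Fin 3 → ℂ)
      + (u j).im • (Complex.I • (Pi.single j 1 : Fin 3 → ℂ))) := by
    ext i
    simp [Finset.sum_apply, Pi.single_apply, Finset.sum_add_distrib]
  rw [hu]
  simp only [map_sum, map_add, map_smul, hb]
  simp

/-- The converse of `volWedge_torsionTerm_im` for `θ = id`: on suitable vectors `Pi.single a 1` and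
`i • Pi.single a 1` the 4-form gives the entries of `N - Nᴴ`. -/
theorem isHermitian_of_volWedge_im {N : Matrix (Fin 3) (Fin 3) ℂ}
    (h : ∀ u v w z, (volWedge (torsionTerm N id) id u v w z).im = 0) : N.IsHermitian := by
  have hN : ∀ j k : Fin 3, (N j k).re = (N k j).re ∧ (N j k).im = -(N k j).im := by
    have key : ∀ a b c d : Fin 3, ∀ s t : ℂ, _ := fun a b c d s t =>
      h (s • Pi.single a 1) (t • Pi.single b 1) (Pi.single c 1) (Pi.single d 1)
    have d0 := key 1 2 1 2 Complex.I Complex.I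
    have d1 := key 2 0 2 0 Complex.I Complex.I
    have d2 := key 0 1 0 1 Complex.I Complex.I
    have f0 := key 0 0 1 2 Complex.I 1
    have f1 := key 1 1 2 0 Complex.I 1
    have f2 := key 2 2 0 1 Complex.I 1
    have g0 := h (Complex.I • Pi.single 0 1) (Pi.single 0 1)
      (Pi.single 1 1) (Complex.I • Pi.single 2 1)
    have g1 := h (Complex.I • Pi.single 1 1) (Pi.single 1 1)
      (Pi.single 2 1) (Complex.I • Pi.single 0 1)
    have g2 := h (Complex.I • Pi.single 2 1) (Pi.single 2 1)
      (Pi.single 0 1) (Complex.I • Pi.single 1 1)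
    simp [volWedge, torsionTerm, vol_eq, cross_apply, Matrix.mulVec, dotProduct,
      Fin.sum_univ_three] at d0 d1 d2 f0 f1 f2 g0 g1 g2
    intro j k
    fin_cases j <;> fin_cases k <;> simp only [Fin.zero_eta, Fin.mk_one, Fin.reduceFinMk] <;>
      constructor <;> first | trivial | linarith
  ext j k
  rw [Matrix.conjTranspose_apply]
  apply Complex.ext
  · simpa using (hN k j).1
  · simpa using neg_eq_iff_eq_neg.2 (hN k j).2

/-- A torsion form `τ` which satisfies the algebraic conditions given by `d Ω = 0` and
`d (Im Ψ) = 0` is absorbed by a connection up to a trace-free Hermitian matrix. -/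
theorem exists_torsion (halt : ∀ u, τ u u = 0)
    (h1 : ∀ u v w, (hermWedge (fun a b => τ a b) id u v w).im = 0)
    (h2 : ∀ u v w z, (volWedge (fun a b => τ a b) id u v w z).im = 0) :
    (∀ w, (torsionConn (fun a b => τ a b) w).trace = 0) ∧
      ∃ N : Matrix (Fin 3) (Fin 3) ℂ, N.IsHermitian ∧ N.trace = 0 ∧ ∀ u v,
        τ u v = -matWedge (torsionConn fun a b => τ a b) id u v + torsionTerm N id u v := by
  set B := mixedPart (fun a b => τ a b) with hB
  set A := torsionConn (fun a b => τ a b) with hA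
  have hAskew : ∀ w, (A w)ᴴ = -A w := torsionConn_conjTranspose _
  have hI : ∀ v : Fin 3 → ℂ, Complex.I • Complex.I • v = -v := by
    intro v; rw [smul_smul]; simp
  have hskew : ∀ u v, τ u v = -τ v u := by
    intro u v
    have := halt (u + v)
    simp only [map_add, LinearMap.add_apply, halt, zero_add, add_zero] at this
    exact eq_neg_of_add_eq_zero_right this
  have hAadd : ∀ u v, A (u + v) = A u + A v := torsionConn_add τ
  have hAsmul : ∀ (c : ℝ) u, A (c • u) = c • A u := torsionConn_smul τ
  -- the torsion that remains is shown to be of type `(0, 2)`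
  let T : (Fin 3 → ℂ) →ₗ[ℝ] (Fin 3 → ℂ) →ₗ[ℝ] (Fin 3 → ℂ) :=
    LinearMap.mk₂ ℝ (fun u v => τ u v + matWedge A id u v)
      (by intro u v w; simp only [matWedge, hAadd, id, Matrix.add_mulVec, Matrix.mulVec_add,
            map_add, LinearMap.add_apply]; abel)
      (by intro c u w; simp only [matWedge, hAsmul, id, Matrix.smul_mulVec, Matrix.mulVec_smul,
            map_smul, LinearMap.smul_apply, smul_add, smul_sub])
      (by intro u v w; simp only [matWedge, hAadd, id, Matrix.add_mulVec, Matrix.mulVec_add,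
            map_add]; abel)
      (by intro c u w; simp only [matWedge, hAsmul, id, Matrix.smul_mulVec, Matrix.mulVec_smul,
            map_smul, smul_add, smul_sub])
  have hT : ∀ u v, T u v = τ u v + matWedge A id u v := fun u v => rfl
  have hTalt : ∀ u, T u u = 0 := by
    intro u; simp [hT, halt, matWedge]
  -- `T` has no component of type `(1, 1)`, by the choice of `A`
  have hTI : ∀ u v, T (Complex.I • u) (Complex.I • v) = -T u v := by
    intro u v
    have hBI : ∀ w, B (Complex.I • w) = -Complex.I • B w := mixedPart_I_smul τ
    have e : ∀ u v, A (Complex.I • u) *ᵥ (Complex.I • v) = (B u + (B u)ᴴ) *ᵥ v := by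
      intro u v
      simp only [hA, torsionConn, ← hB, hBI, Matrix.mulVec_smul, Matrix.conjTranspose_smul,
        Matrix.sub_mulVec, Matrix.add_mulVec, Matrix.smul_mulVec, smul_sub, smul_smul]
      simp
    have e' : ∀ u v, A u *ᵥ v = B u *ᵥ v - (B u)ᴴ *ᵥ v := by
      intro u v
      simp only [hA, torsionConn, ← hB, Matrix.sub_mulVec]
    have k1 := mixedPart_mulVec τ u v
    have k2 := mixedPart_mulVec τ v u
    rw [← hB] at k1 k2
    simp only [hT, matWedge, id, e, e', Matrix.add_mulVec, k1, k2, hskew v u,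
      hskew (Complex.I • v) (Complex.I • u), hskew (Complex.I • v) u, hskew v (Complex.I • u)]
    ext i
    simp only [Pi.smul_apply, Pi.add_apply, Pi.sub_apply, Pi.neg_apply, smul_eq_mul]
    ring
  have hT1 : ∀ u v w, (hermWedge (fun a b => T a b) id u v w).im = 0 := by
    intro u v w
    simp only [hT]
    rw [hermWedge_add (fun a b => τ a b), Complex.add_im, h1, hermWedge_matWedge_im hAskew,
      add_zero]
  have hT2 : ∀ u v, T (Complex.I • u) v = -Complex.I • T u v := fun u v =>
    (map_I_smul_of_hermWedge_im hTI hT1 u v 0).1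
  obtain ⟨N, hN⟩ := eq_torsionTerm hTalt hT2
  let a : (Fin 3 → ℂ) →ₗ[ℝ] ℂ :=
    { toFun := fun u => (A u).trace
      map_add' := fun u v => by rw [hAadd, Matrix.trace_add]
      map_smul' := fun c u => by rw [hAsmul, Matrix.trace_smul]; rfl }
  have hatr : ∀ u, (A u).trace = 0 := by
    refine trace_eq_zero_of_volWedge_im (T := T) (a := a) ?_ hTalt hT2 ?_
    · intro u
      have := congrArg (fun M => (Matrix.trace M).re) (hAskew u)
      simp only [Matrix.trace_conjTranspose, Matrix.trace_neg, Complex.neg_re] at this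
      have h' : (star (A u).trace).re = (A u).trace.re := by simp
      rw [h'] at this
      change (A u).trace.re = 0
      linarith
    · intro u v w z
      simp only [hT]
      rw [volWedge_add (fun a b => τ a b), Complex.add_im, h2, volWedge_matWedge, zero_add]
      rfl
  refine ⟨hatr, N, ?_, ?_, fun u v => ?_⟩
  · apply isHermitian_of_volWedge_im
    intro u v w z
    have : torsionTerm N id = fun u v => τ u v + matWedge A id u v := by
      funext u v; rw [← hN, hT]
    rw [this, volWedge_add (fun a b => τ a b), Complex.add_im, h2, volWedge_matWedge]
    simp [hatr]
  · have := (map_I_smul_of_hermWedge_im hTI hT1 (Pi.single 0 1) (Pi.single 1 1)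
      (Pi.single 2 1)).2
    simp only [hN] at this
    change hermWedge (torsionTerm N id) id _ _ _ = 0 at this
    rw [hermWedge_torsionTerm] at this
    simpa [vol_eq] using this
  · rw [← hN, hT]; abel

end Torsion

/-- A `𝔲(3)`-valued 1-form `A` on `ℂ³` for which `A ∧ z` is of type `(0, 2)` vanishes: `A` is
complex linear, but its values are skew-Hermitian. -/
theorem eq_zero_of_matWedge_eq_torsionTerm {A : (Fin 3 → ℂ) → Matrix (Fin 3) (Fin 3) ℂ}
    (hA : ∀ u, (A u)ᴴ = -A u) {N : Matrix (Fin 3) (Fin 3) ℂ}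
    (h : ∀ u v, matWedge A id u v = torsionTerm N id u v) (u : Fin 3 → ℂ) : A u = 0 := by
  have hl : ∀ u v, torsionTerm N id (Complex.I • u) v = -Complex.I • torsionTerm N id u v := by
    intro u v; simp [torsionTerm, Matrix.mulVec_smul, star_smul, Matrix.mulVec_neg]
  have hr : ∀ u v, torsionTerm N id u (Complex.I • v) = -Complex.I • torsionTerm N id u v := by
    intro u v; simp [torsionTerm, Matrix.mulVec_smul, star_smul, Matrix.mulVec_neg]
  have hI : ∀ (x : Fin 3 → ℂ), Complex.I • Complex.I • x = -x := by
    intro v; rw [smul_smul]; simp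
  have key : ∀ v, A (Complex.I • u) *ᵥ v = (Complex.I • A u) *ᵥ v := by
    intro v
    have e1 := hl u v
    have e2 := hr u v
    have e3 := hr (Complex.I • u) v
    rw [hl u v] at e3
    rw [← h, ← h] at e1 e2 e3
    simp only [matWedge, id, Matrix.mulVec_smul] at e1 e2 e3
    rw [Matrix.smul_mulVec]
    ext i
    have e1 := congrFun e1 i
    have e2 := congrFun e2 i
    have e3 := congrFun e3 i
    simp only [Pi.smul_apply, Pi.sub_apply, smul_eq_mul] at e1 e2 e3 ⊢
    linear_combination e1 - Complex.I / 2 * (e3 - Complex.I * e1 - Complex.I * e2)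
      - 2 * Complex.I * ((A u *ᵥ v) i - (A v *ᵥ u) i) * Complex.I_sq
  have key2 : A (Complex.I • u) = Complex.I • A u := Matrix.ext_of_mulVec_single fun i => key _
  have h2 := hA (Complex.I • u)
  rw [key2, Matrix.conjTranspose_smul, hA] at h2
  ext i j
  have h3 := congrFun (congrFun h2 i) j
  simp at h3
  have h4 : Complex.I * A u i j = 0 := by linear_combination (1/2 : ℂ) * h3
  simpa using h4

/-- A `𝔲(3)`-valued form which satisfies structure equations with torsion of type `(0, 2)` is
determined by them, whatever the torsion is. -/
theorem eq_of_matWedge_add_torsionTerm {V : Type*} [AddCommGroup V] {θ : V → Fin 3 → ℂ}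
    (hθ : Function.Surjective θ) (hθsub : ∀ u v, θ (u - v) = θ u - θ v)
    {A A' : V → Matrix (Fin 3) (Fin 3) ℂ} (hA : ∀ u, (A u)ᴴ = -A u) (hA' : ∀ u, (A' u)ᴴ = -A' u)
    (hAsub : ∀ u v, A (u - v) = A u - A v) (hAsub' : ∀ u v, A' (u - v) = A' u - A' v)
    {N N' : Matrix (Fin 3) (Fin 3) ℂ}
    (h : ∀ u v, -matWedge A θ u v + torsionTerm N θ u v =
      -matWedge A' θ u v + torsionTerm N' θ u v) (u : V) : A u = A' u := by
  have h' : ∀ u v, matWedge (fun u => A u - A' u) θ u v = torsionTerm (N - N') θ u v := by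
    intro u v
    have := h u v
    simp only [matWedge, torsionTerm, Matrix.sub_mulVec] at this ⊢
    linear_combination (exp := 1) -this
  -- the difference of the two forms factors through `θ`
  have hker : ∀ u, θ u = 0 → A u - A' u = 0 := by
    intro u hu
    refine Matrix.ext_of_mulVec_single fun i => ?_
    obtain ⟨v, hv⟩ := hθ (Pi.single i 1)
    have := h' u v
    simp only [matWedge, torsionTerm, hu, hv, Matrix.mulVec_zero, sub_zero, star_zero, map_zero,
      LinearMap.zero_apply] at this
    rw [this, Matrix.zero_mulVec]
  have hr := Function.surjInv_eq hθ
  have h0 := eq_zero_of_matWedge_eq_torsionTerm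
    (A := fun x => A (Function.surjInv hθ x) - A' (Function.surjInv hθ x)) (N := N - N')
    (fun x => by rw [Matrix.conjTranspose_sub, hA, hA']; abel)
    (fun x y => by
      have := h' (Function.surjInv hθ x) (Function.surjInv hθ y)
      simpa [matWedge, torsionTerm, hr] using this) (θ u)
  have h1 := hker (u - Function.surjInv hθ (θ u)) (by rw [hθsub, hr, sub_self])
  rw [hAsub, hAsub'] at h1
  have h0' : A (Function.surjInv hθ (θ u)) = A' (Function.surjInv hθ (θ u)) := sub_eq_zero.1 h0
  rw [h0', sub_sub_sub_cancel_right, sub_eq_zero] at h1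
  exact h1

/-! ### Calculus in charts -/

/-- The product of a matrix and a vector, as a bounded bilinear map over `ℝ`. -/
def mulVecL : (Fin 3 → Fin 3 → ℂ) →L[ℝ] (Fin 3 → ℂ) →L[ℝ] (Fin 3 → ℂ) :=
  LinearMap.toContinuousLinearMap
    { toFun := fun A => LinearMap.toContinuousLinearMap
        (((Matrix.of A : Matrix (Fin 3) (Fin 3) ℂ).mulVecLin).restrictScalars ℝ)
      map_add' := fun A B => by
        ext x i
        simp [← Matrix.of_add_of]
      map_smul' := fun c A => by
        ext x i
        simp [← Matrix.smul_of] }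

theorem mulVecL_apply (A : Fin 3 → Fin 3 → ℂ) (x : Fin 3 → ℂ) :
    mulVecL A x = (Matrix.of A : Matrix (Fin 3) (Fin 3) ℂ) *ᵥ x := rfl

section Calculus

variable {E F : Type*} [NormedAddCommGroup E] [NormedSpace ℝ E]
  [NormedAddCommGroup F] [NormedSpace ℝ F]

/-- The derivative of the matrix multiple `h · f^* η` of the pull-back of a vector valued 1-form
`η`. The second conclusion is the formula `d (h · f^* η) = dh ∧ f^* η + h · f^* dη`, in which the
second derivatives of `f` cancel. -/
theorem hasFDerivAt_mulVecL_comp {η : E → E →L[ℝ] (Fin 3 → ℂ)} {f : F → E}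
    {h : F → Fin 3 → Fin 3 → ℂ} {z : F} (hη : DifferentiableAt ℝ η (f z))
    (hf : ContDiffAt ℝ 2 f z) (hh : DifferentiableAt ℝ h z) :
    ∃ D : F →L[ℝ] F →L[ℝ] (Fin 3 → ℂ),
      HasFDerivAt (fun z => mulVecL (h z) ∘L (η (f z) ∘L fderiv ℝ f z)) D z ∧
      ∀ u v, D u v - D v u =
        (Matrix.of (fderiv ℝ h z u) : Matrix (Fin 3) (Fin 3) ℂ) *ᵥ η (f z) (fderiv ℝ f z v)
        - (Matrix.of (fderiv ℝ h z v) : Matrix (Fin 3) (Fin 3) ℂ) *ᵥ η (f z) (fderiv ℝ f z u)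
        + (Matrix.of (h z) : Matrix (Fin 3) (Fin 3) ℂ) *ᵥ
          (fderiv ℝ η (f z) (fderiv ℝ f z u) (fderiv ℝ f z v)
            - fderiv ℝ η (f z) (fderiv ℝ f z v) (fderiv ℝ f z u)) := by
  have hf1 : DifferentiableAt ℝ f z := hf.differentiableAt (by norm_num)
  have hf2 : DifferentiableAt ℝ (fderiv ℝ f) z :=
    (hf.fderiv_right (m := 1) (by norm_num)).differentiableAt (by norm_num)
  have h1 : HasFDerivAt (fun z => η (f z)) (fderiv ℝ η (f z) ∘L fderiv ℝ f z) z :=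
    hη.hasFDerivAt.comp z hf1.hasFDerivAt
  have h2 := h1.clm_comp hf2.hasFDerivAt
  have h3 := (mulVecL.hasFDerivAt.comp z hh.hasFDerivAt).clm_comp h2
  refine ⟨_, h3, fun u v => ?_⟩
  have hs : fderiv ℝ (fderiv ℝ f) z u v = fderiv ℝ (fderiv ℝ f) z v u :=
    (hf.isSymmSndFDerivAt (by simp)).eq u v
  simp [mulVecL_apply, Matrix.mulVec_sub, hs]
  abel

/-- If `g` has values in `SU(3)`, then `dg g⁻¹` has values in `𝔰𝔲(3)`. -/
theorem special_unitary_deriv {g : F → Fin 3 → Fin 3 → ℂ} {z : F} (hg : DifferentiableAt ℝ g z)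
    (hU : ∀ᶠ y in nhds z, (Matrix.of (g y) : Matrix (Fin 3) (Fin 3) ℂ) ∈
      Matrix.specialUnitaryGroup (Fin 3) ℂ) (u : F) :
    ((Matrix.of (fderiv ℝ g z u) : Matrix (Fin 3) (Fin 3) ℂ) * (Matrix.of (g z))ᴴ)ᴴ =
      -((Matrix.of (fderiv ℝ g z u) : Matrix (Fin 3) (Fin 3) ℂ) * (Matrix.of (g z))ᴴ) ∧
    ((Matrix.of (fderiv ℝ g z u) : Matrix (Fin 3) (Fin 3) ℂ) * (Matrix.of (g z))ᴴ).trace = 0 := by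
  have he : ∀ i j, HasFDerivAt (fun y => g y i j)
      ((ContinuousLinearMap.proj j : (Fin 3 → ℂ) →L[ℝ] ℂ) ∘L
        ((ContinuousLinearMap.proj i : (Fin 3 → Fin 3 → ℂ) →L[ℝ] (Fin 3 → ℂ)) ∘L fderiv ℝ g z)) z :=
    fun i j => (hasFDerivAt_pi'.1 (hasFDerivAt_pi'.1 hg.hasFDerivAt i) j)
  have hz := hU.self_of_nhds
  constructor
  · rw [Matrix.conjTranspose_mul, Matrix.conjTranspose_conjTranspose, eq_neg_iff_add_eq_zero]
    ext i j
    have hc : (fun y => ∑ k, g y i k * star (g y j k)) =ᶠ[nhds z]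
        fun _ => (1 : Matrix (Fin 3) (Fin 3) ℂ) i j := by
      filter_upwards [hU] with y hy
      have := Matrix.mem_unitaryGroup_iff.1 (Matrix.mem_specialUnitaryGroup_iff.1 hy).1
      rw [← this]
      rfl
    have hd : HasFDerivAt (fun y => ∑ k, g y i k * star (g y j k)) _ z :=
      HasFDerivAt.fun_sum fun k _ => (he i k).mul (he j k).star
    have h0 := hd.unique ((hasFDerivAt_const _ z).congr_of_eventuallyEq hc)
    have h0 := DFunLike.congr_fun h0 u
    simp [Fin.sum_univ_three] at h0
    simp [Matrix.mul_apply, Fin.sum_univ_three]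
    linear_combination h0
  · set X := (Matrix.of (fderiv ℝ g z u) : Matrix (Fin 3) (Fin 3) ℂ) * (Matrix.of (g z))ᴴ with hX
    have hXg : X * Matrix.of (g z) = Matrix.of (fderiv ℝ g z u) := by
      rw [hX, Matrix.mul_assoc]
      have := Matrix.mem_unitaryGroup_iff'.1 (Matrix.mem_specialUnitaryGroup_iff.1 hz).1
      rw [Matrix.star_eq_conjTranspose] at this
      rw [this, Matrix.mul_one]
    -- `tr X = det (X g₀, g₁, g₂) + det (g₀, X g₁, g₂) + det (g₀, g₁, X g₂)` is the derivative of
    -- `det g = 1`, where `gⱼ` are the columns of `g`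
    have hc : (fun y => g y 0 0 * (g y 1 1 * g y 2 2 - g y 2 1 * g y 1 2)
        + g y 1 0 * (g y 2 1 * g y 0 2 - g y 0 1 * g y 2 2)
        + g y 2 0 * (g y 0 1 * g y 1 2 - g y 1 1 * g y 0 2)) =ᶠ[nhds z] fun _ => (1 : ℂ) := by
      filter_upwards [hU] with y hy
      have := (Matrix.mem_specialUnitaryGroup_iff.1 hy).2
      rw [Matrix.det_fin_three] at this
      rw [← this]
      simp only [Matrix.of_apply]
      ring
    have hd := (((he 0 0).mul (((he 1 1).mul (he 2 2)).sub ((he 2 1).mul (he 1 2)))).add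
      ((he 1 0).mul (((he 2 1).mul (he 0 2)).sub ((he 0 1).mul (he 2 2))))).add
      ((he 2 0).mul (((he 0 1).mul (he 1 2)).sub ((he 1 1).mul (he 0 2))))
    have h0 := hd.unique ((hasFDerivAt_const _ z).congr_of_eventuallyEq hc)
    have h0 := DFunLike.congr_fun h0 u
    have ht := vol_trace X (fun i => g z i 0) (fun i => g z i 1) (fun i => g z i 2)
    have hcol : ∀ j, X *ᵥ (fun i => g z i j) = fun i => fderiv ℝ g z u i j := by
      intro j
      ext i
      exact congrFun (congrFun hXg i) j
    have h1 : vol (fun i => g z i 0) (fun i => g z i 1) (fun i => g z i 2) = 1 := by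
      rw [vol_eq]
      exact hc.self_of_nhds
    rw [hcol, hcol, hcol, h1, mul_one] at ht
    rw [← ht]
    simp only [vol_eq]
    simp at h0
    linear_combination h0

end Calculus

section Charts

variable {n : ℕ} {X : Type*} [TopologicalSpace X] [ChartedSpace (EuclideanSpace ℝ (Fin n)) X]

/-- The derivative at `y` of the inverse of the preferred chart at `x`, as an endomorphism of the
model space. -/
def chartSymmDeriv (x : X) (y : EuclideanSpace ℝ (Fin n)) :
    EuclideanSpace ℝ (Fin n) →L[ℝ] EuclideanSpace ℝ (Fin n) :=
  mfderiv 𝓘(ℝ, EuclideanSpace ℝ (Fin n)) (𝓡 n) (extChartAt (𝓡 n) x).symm y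

variable [IsManifold (𝓡 n) ∞ X]

instance : IsManifold (𝓡 n) 1 X := IsManifold.of_le (n := ∞) (by norm_num)

theorem mextDeriv_apply {F : Type*} [NormedAddCommGroup F] [NormedSpace ℝ F] {k : ℕ}
    (θ : ∀ x : X, TangentSpace (𝓡 n) x [⋀^Fin k]→L[ℝ] F) (x : X)
    (v : Fin (k + 1) → EuclideanSpace ℝ (Fin n)) :
    (mextDeriv θ x : (Fin (k + 1) → EuclideanSpace ℝ (Fin n)) → F) v =
      extDeriv (fun y : EuclideanSpace ℝ (Fin n) =>
        ContinuousAlternatingMap.compContinuousLinearMap (M := EuclideanSpace ℝ (Fin n))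
          (M' := EuclideanSpace ℝ (Fin n))
          (θ ((extChartAt (𝓡 n) x).symm y)) (chartSymmDeriv x y)) (extChartAt (𝓡 n) x x) v := by
  unfold mextDeriv
  rw [mfderiv_extChartAt_self]
  rfl

end Charts

/-- The exterior derivative of the pull-back `Θ^* A` of a constant form `A`. -/
theorem extDeriv_comp_apply {E G : Type*} [NormedAddCommGroup E] [NormedSpace ℝ E]
    [NormedAddCommGroup G] [NormedSpace ℝ G] {k : ℕ} (A : (Fin 3 → ℂ) [⋀^Fin k]→L[ℝ] G)
    {θ : E → E [⋀^Fin k]→L[ℝ] G} {Θ : E → E →L[ℝ] (Fin 3 → ℂ)} {z : E}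
    {D : E →L[ℝ] E →L[ℝ] (Fin 3 → ℂ)}
    (h : ∀ᶠ y in nhds z, θ y = A.compContinuousLinearMap (Θ y)) (hΘ : HasFDerivAt Θ D z)
    (v : Fin (k + 1) → E) :
    extDeriv θ z v = ∑ i, (-1) ^ i.val • ∑ j, A (Function.update
      (fun l => Θ z (i.removeNth v l)) j (D (v i) (i.removeNth v j))) := by
  have h' : θ =ᶠ[nhds z] fun y => A.compContinuousLinearMap (Θ y) := h
  have hd : DifferentiableAt ℝ (fun y => A.compContinuousLinearMap (Θ y)) z :=
    (differentiableAt_const A).continuousAlternatingMapCompContinuousLinearMap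
      hΘ.differentiableAt
  rw [h'.extDeriv_eq, extDeriv_apply hd]
  refine Finset.sum_congr rfl fun i _ => ?_
  congr 1
  have h1 : ∀ l, HasFDerivAt (fun y => Θ y (i.removeNth v l))
      ((ContinuousLinearMap.apply ℝ (Fin 3 → ℂ) (i.removeNth v l)) ∘L D) z := fun l =>
    (ContinuousLinearMap.apply ℝ (Fin 3 → ℂ) (i.removeNth v l)).hasFDerivAt.comp z hΘ
  have h2 := A.toContinuousMultilinearMap.hasFDerivAt (fun l => Θ z (i.removeNth v l))
  have h3 := h2.comp z (hasFDerivAt_pi.2 h1)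
  have h4 : HasFDerivAt (fun y => A.compContinuousLinearMap (Θ y) (i.removeNth v)) _ z := h3
  rw [h4.fderiv]
  simp [ContinuousMultilinearMap.linearDeriv_apply]

/-! ### Exterior derivatives of pulled back forms -/

section ExtDeriv

variable {E : Type*} [NormedAddCommGroup E] [NormedSpace ℝ E]
  {Θ : E → E →L[ℝ] (Fin 3 → ℂ)} {z : E} {D : E →L[ℝ] E →L[ℝ] (Fin 3 → ℂ)}

theorem extDeriv_dz_comp {θ : E → E [⋀^Fin 1]→L[ℝ] ℂ} (i : Fin 3)
    (h : ∀ᶠ y in nhds z, θ y = (ContinuousAlternatingMap.ofSubsingleton ℝ (Fin 3 → ℂ) ℂ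
      (0 : Fin 1) (dz i)).compContinuousLinearMap (Θ y)) (hΘ : HasFDerivAt Θ D z)
    (v : Fin 2 → E) : extDeriv θ z v = (D (v 0) (v 1) - D (v 1) (v 0)) i := by
  rw [extDeriv_comp_apply _ h hΘ]
  simp [Fin.sum_univ_two, Fin.removeNth, dz, sub_eq_add_neg]

theorem extDeriv_Omega0_comp {θ : E → E [⋀^Fin 2]→L[ℝ] ℂ}
    (h : ∀ᶠ y in nhds z, θ y = Omega0.compContinuousLinearMap (Θ y)) (hΘ : HasFDerivAt Θ D z)
    (v : Fin 3 → E) : extDeriv θ z v =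
      ((-(hermWedge (fun a b => D a b - D b a) (Θ z) (v 0) (v 1) (v 2)).im : ℝ) : ℂ) := by
  have hs : ∀ x y : Fin 3 → ℂ, (x ⬝ᵥ star y).im = -(y ⬝ᵥ star x).im := by
    intro x y
    have : x ⬝ᵥ star y = star (y ⬝ᵥ star x) := by
      rw [← Matrix.star_dotProduct_star, star_star, dotProduct_comm]
    rw [this]; simp
  rw [extDeriv_comp_apply _ h hΘ]
  refine (Fin.sum_univ_three _).trans ?_
  simp only [Fin.sum_univ_two, Fin.removeNth, Omega0_eq_im]
  have e0 : (1 : Fin 3).succAbove (0 : Fin 2) = 0 := rfl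
  have e1 : (1 : Fin 3).succAbove (1 : Fin 2) = 2 := rfl
  have e2 : (2 : Fin 3).succAbove (0 : Fin 2) = 0 := rfl
  have e3 : (2 : Fin 3).succAbove (1 : Fin 2) = 1 := rfl
  simp [hermWedge, e0, e1, e2, e3]
  rw [hs (Θ z (v 1)) (D (v 0) (v 2)), hs (Θ z (v 0)) (D (v 1) (v 2)),
    hs (Θ z (v 0)) (D (v 2) (v 1))]
  push_cast
  ring

theorem extDeriv_im_Psi0_comp {θ : E → E [⋀^Fin 3]→L[ℝ] ℝ}
    (h : ∀ᶠ y in nhds z, θ y =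
      (Complex.imCLM.compContinuousAlternatingMap Psi0).compContinuousLinearMap (Θ y))
    (hΘ : HasFDerivAt Θ D z) (v : Fin 4 → E) : extDeriv θ z v =
      (volWedge (fun a b => D a b - D b a) (Θ z) (v 0) (v 1) (v 2) (v 3)).im := by
  rw [extDeriv_comp_apply _ h hΘ]
  have e : ∀ x, (Complex.imCLM.compContinuousAlternatingMap Psi0) x =
    (vol (x 0) (x 1) (x 2)).im := fun x => by rw [← Psi0_eq_vol]; rfl
  refine (Fin.sum_univ_four _).trans ?_
  simp only [Fin.sum_univ_three, Fin.removeNth, e]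
  have hv1 : ∀ a b x y, (vol x y (D a b)).im = (vol (D a b) x y).im := by
    intro a b x y; congr 1; simp only [vol_eq]; ring
  have hv2 : ∀ a b x y, (vol x (D a b) y).im = -(vol (D a b) x y).im := by
    intro a b x y; rw [← Complex.neg_im]; congr 1; simp only [vol_eq]; ring
  have hsub : ∀ x x' y z : Fin 3 → ℂ, vol (x - x') y z = vol x y z - vol x' y z := by
    intro x x' y z; simp [vol]
  have e0 : (1 : Fin 4).succAbove (0 : Fin 3) = 0 := rfl
  have e1 : (1 : Fin 4).succAbove (1 : Fin 3) = 2 := rfl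
  have e2 : (1 : Fin 4).succAbove (2 : Fin 3) = 3 := rfl
  have e3 : (2 : Fin 4).succAbove (0 : Fin 3) = 0 := rfl
  have e4 : (2 : Fin 4).succAbove (1 : Fin 3) = 1 := rfl
  have e5 : (2 : Fin 4).succAbove (2 : Fin 3) = 3 := rfl
  have e6 : (3 : Fin 4).succAbove (0 : Fin 3) = 0 := rfl
  have e7 : (3 : Fin 4).succAbove (1 : Fin 3) = 1 := rfl
  have e8 : (3 : Fin 4).succAbove (2 : Fin 3) = 2 := rfl
  simp [volWedge, hsub, Function.update, e0, e1, e2, e3, e4, e5, e6, e7, e8]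
  simp only [hv1, hv2]
  ring

end ExtDeriv

namespace SU3Structure

variable {M : Type*} [TopologicalSpace M] [ChartedSpace (EuclideanSpace ℝ (Fin 6)) M]
  [IsManifold (𝓡 6) ∞ M]
  {P : Type*} [TopologicalSpace P] [ChartedSpace (EuclideanSpace ℝ (Fin 14)) P]
  [IsManifold (𝓡 14) ∞ P] (S : SU3Structure M P)

/-- The coframe at a point of `P`, as a linear map on the model space of `M`. -/
def cof (q : P) : EuclideanSpace ℝ (Fin 6) →L[ℝ] (Fin 3 → ℂ) :=
  (S.coframe q : TangentSpace (𝓡 6) (S.proj q) →L[ℝ] (Fin 3 → ℂ))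

/-- The coframe at a point of `P`, as an isomorphism from the model space of `M`. -/
def cofEquiv (q : P) : EuclideanSpace ℝ (Fin 6) ≃L[ℝ] (Fin 3 → ℂ) := S.coframe q

/-- The derivative of the bundle projection, as a linear map of the model spaces. -/
def dproj (q : P) : EuclideanSpace ℝ (Fin 14) →L[ℝ] EuclideanSpace ℝ (Fin 6) :=
  mfderiv (𝓡 14) (𝓡 6) S.proj q

theorem cof_act (p : P) (a : SU3) (v : EuclideanSpace ℝ (Fin 6)) :
    S.cof (S.act p a) v = ((a⁻¹ : SU3) : Matrix (Fin 3) (Fin 3) ℂ) *ᵥ S.cof p v :=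
  S.coframe_act p a v

theorem Omega_eq (q : P) (x : M) (h : S.proj q = x) :
    (S.Omega x : EuclideanSpace ℝ (Fin 6) [⋀^Fin 2]→L[ℝ] ℂ) =
      Omega0.compContinuousLinearMap (S.cof q) := by
  subst h
  exact S.Omega_proj q

theorem imPsi_eq (q : P) (x : M) (h : S.proj q = x) :
    (S.imPsi x : EuclideanSpace ℝ (Fin 6) [⋀^Fin 3]→L[ℝ] ℝ) =
      (Complex.imCLM.compContinuousAlternatingMap Psi0).compContinuousLinearMap (S.cof q) := by
  subst h
  unfold imPsi
  rw [S.Psi_proj q]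
  rfl

end SU3Structure

/-! ### The coframes in charts -/

/-- The inverse of the preferred trivialization of the tangent bundle is given by the derivative of
the inverse of the chart. -/
theorem symmL_apply_eq {n : ℕ} {X : Type*} [TopologicalSpace X]
    [ChartedSpace (EuclideanSpace ℝ (Fin n)) X] [IsManifold (𝓡 n) ∞ X] {x x' : X}
    (h : x' ∈ (chartAt (EuclideanSpace ℝ (Fin n)) x).source) (v : EuclideanSpace ℝ (Fin n)) :
    ((trivializationAt (EuclideanSpace ℝ (Fin n)) (TangentSpace (𝓡 n)) x).symmL ℝ x' v :
      EuclideanSpace ℝ (Fin n)) = chartSymmDeriv x (extChartAt (𝓡 n) x x') v := by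
  rw [TangentBundle.symmL_trivializationAt h, ModelWithCorners.range_eq_univ, mfderivWithin_univ]
  rfl

namespace SU3Structure

variable {M : Type*} [TopologicalSpace M] [ChartedSpace (EuclideanSpace ℝ (Fin 6)) M]
  [IsManifold (𝓡 6) ∞ M]
  {P : Type*} [TopologicalSpace P] [ChartedSpace (EuclideanSpace ℝ (Fin 14)) P]
  [IsManifold (𝓡 14) ∞ P] (S : SU3Structure M P)

/-- The coframe `q` read in the preferred chart of `M` at `x`. -/
def chartCof (x : M) (q : P) : EuclideanSpace ℝ (Fin 6) →L[ℝ] (Fin 3 → ℂ) :=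
  S.cof q ∘L chartSymmDeriv x (extChartAt (𝓡 6) x (S.proj q))

theorem contMDiffOn_chartCof (x : M) :
    ContMDiffOn (𝓡 14) 𝓘(ℝ, EuclideanSpace ℝ (Fin 6) →L[ℝ] (Fin 3 → ℂ)) ∞ (S.chartCof x)
      (S.proj ⁻¹' (chartAt (EuclideanSpace ℝ (Fin 6)) x).source) := by
  have h := S.contMDiff_coframe.contMDiffOn
    (s := S.proj ⁻¹' (chartAt (EuclideanSpace ℝ (Fin 6)) x).source)
  rw [Bundle.Trivialization.contMDiffOn_iff
        (e := trivializationAt (EuclideanSpace ℝ (Fin 6) →L[ℝ] (Fin 3 → ℂ))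
          (fun x : M => TangentSpace (𝓡 6) x →L[ℝ] Bundle.Trivial M (Fin 3 → ℂ) x) x)] at h
  · refine h.2.congr fun q hq => ?_
    rw [hom_trivializationAt_apply]
    have e1 : ∀ v : EuclideanSpace ℝ (Fin 6), ((trivializationAt (EuclideanSpace ℝ (Fin 6))
        (TangentSpace (𝓡 6)) x).symmL ℝ (S.proj q) v : EuclideanSpace ℝ (Fin 6)) =
        chartSymmDeriv x (extChartAt (𝓡 6) x (S.proj q)) v := fun v => symmL_apply_eq hq v
    have e2 : ∀ w, (trivializationAt (Fin 3 → ℂ)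
        (Bundle.Trivial M (Fin 3 → ℂ)) x).continuousLinearMapAt ℝ (S.proj q) w = w :=
      fun w => DFunLike.congr_fun
      (Bundle.Trivial.continuousLinearMapAt_trivialization ℝ M (Fin 3 → ℂ) (S.proj q)) w
    ext1 v
    change S.cof q (chartSymmDeriv x (extChartAt (𝓡 6) x (S.proj q)) v) = _
    rw [← e1]
    exact (e2 _).symm
  · intro q hq
    rw [hom_trivializationAt_source]
    simpa using hq

end SU3Structure

/-! ### Local sections and transition functions -/

namespace SU3Structure

variable {M : Type*} [TopologicalSpace M] [ChartedSpace (EuclideanSpace ℝ (Fin 6)) M]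
  [IsManifold (𝓡 6) ∞ M]
  {P : Type*} [TopologicalSpace P] [ChartedSpace (EuclideanSpace ℝ (Fin 14)) P]
  [IsManifold (𝓡 14) ∞ P] (S : SU3Structure M P)

/-- A smooth local section of `π : P → M`. -/
structure LocalSection where
  /-- the open set on which the section is defined -/
  dom : Set M
  isOpen_dom : IsOpen dom
  /-- the section; its values outside `dom` are irrelevant -/
  sec : M → P
  contMDiffOn_sec : ContMDiffOn (𝓡 6) (𝓡 14) ∞ sec dom
  proj_sec : ∀ y ∈ dom, S.proj (sec y) = y

theorem exists_localSection (x : M) : ∃ σ : S.LocalSection, x ∈ σ.dom := by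
  obtain ⟨U, hU, hx, s, hs, hp⟩ := S.exists_section x
  exact ⟨⟨U, hU, s, hs, hp⟩, hx⟩

/-- The part of `P` over the chart domain at `x₀` and the domain of a section. -/
def domOver (σ : S.LocalSection) (x₀ : M) : Set P :=
  S.proj ⁻¹' (σ.dom ∩ (chartAt (EuclideanSpace ℝ (Fin 6)) x₀).source)

variable {S}
variable (σ : S.LocalSection) (x₀ : M)

theorem isOpen_domOver : IsOpen (S.domOver σ x₀) :=
  (σ.isOpen_dom.inter (chartAt _ x₀).open_source).preimage S.contMDiff_proj.continuous

/-- The coframe field `η = σ^* ω` on `M` given by a section `σ`, read in the chart at `x₀`. -/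
def sectionCof (y : EuclideanSpace ℝ (Fin 6)) : EuclideanSpace ℝ (Fin 6) →L[ℝ] (Fin 3 → ℂ) :=
  S.chartCof x₀ (σ.sec ((extChartAt (𝓡 6) x₀).symm y))

theorem contDiffAt_sectionCof {y : M} (hy : y ∈ σ.dom)
    (hy' : y ∈ (chartAt (EuclideanSpace ℝ (Fin 6)) x₀).source) :
    ContDiffAt ℝ ∞ (sectionCof σ x₀) (extChartAt (𝓡 6) x₀ y) := by
  rw [← contMDiffAt_iff_contDiffAt]
  have hy'' : y ∈ (extChartAt (𝓡 6) x₀).source := by rwa [extChartAt_source]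
  have e : (extChartAt (𝓡 6) x₀).symm (extChartAt (𝓡 6) x₀ y) = y :=
    (extChartAt (𝓡 6) x₀).left_inv hy''
  have h1 : ContMDiffAt 𝓘(ℝ, EuclideanSpace ℝ (Fin 6)) (𝓡 6) ∞ (extChartAt (𝓡 6) x₀).symm
      (extChartAt (𝓡 6) x₀ y) :=
    (contMDiffOn_extChartAt_symm x₀).contMDiffAt
      ((isOpen_extChartAt_target x₀).mem_nhds ((extChartAt (𝓡 6) x₀).map_source hy''))
  have h2 : ContMDiffAt (𝓡 6) (𝓡 14) ∞ σ.sec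
      ((extChartAt (𝓡 6) x₀).symm (extChartAt (𝓡 6) x₀ y)) := by
    rw [e]
    exact σ.contMDiffOn_sec.contMDiffAt (σ.isOpen_dom.mem_nhds hy)
  have h3 : ContMDiffAt (𝓡 14) 𝓘(ℝ, EuclideanSpace ℝ (Fin 6) →L[ℝ] (Fin 3 → ℂ)) ∞ (S.chartCof x₀)
      (σ.sec ((extChartAt (𝓡 6) x₀).symm (extChartAt (𝓡 6) x₀ y))) := by
    rw [e]
    refine (S.contMDiffOn_chartCof x₀).contMDiffAt
      (((chartAt _ x₀).open_source.preimage S.contMDiff_proj.continuous).mem_nhds ?_)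
    change S.proj (σ.sec y) ∈ (chartAt (EuclideanSpace ℝ (Fin 6)) x₀).source
    rwa [σ.proj_sec y hy]
  exact (h3.comp _ h2).comp _ h1

theorem exists_transition (q : P) : ∃ a : SU3, S.proj q ∈ σ.dom →
    S.act q a = σ.sec (S.proj q) := by
  by_cases h : S.proj q ∈ σ.dom
  · obtain ⟨a, ha⟩ := S.exists_act_eq q (σ.sec (S.proj q)) (σ.proj_sec _ h).symm
    exact ⟨a, fun _ => ha⟩
  · exact ⟨1, fun h' => absurd h' h⟩

/-- The element `a` of `SU(3)` with `q · a = σ (π q)`, so that `coframe q = a ∘ σ (π q)`. It is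
arbitrary outside the domain of the section. -/
def transition (q : P) : SU3 := (exists_transition σ q).choose

theorem act_transition {q : P} (h : S.proj q ∈ σ.dom) :
    S.act q (transition σ q) = σ.sec (S.proj q) := (exists_transition σ q).choose_spec h

theorem SU3_mul_conjTranspose (a : SU3) :
    (a : Matrix (Fin 3) (Fin 3) ℂ) * (a : Matrix (Fin 3) (Fin 3) ℂ)ᴴ = 1 :=
  Matrix.mem_unitaryGroup_iff.1 (Matrix.mem_specialUnitaryGroup_iff.1 a.2).1

theorem SU3_conjTranspose_mul (a : SU3) :
    (a : Matrix (Fin 3) (Fin 3) ℂ)ᴴ * (a : Matrix (Fin 3) (Fin 3) ℂ) = 1 :=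
  Matrix.mem_unitaryGroup_iff'.1 (Matrix.mem_specialUnitaryGroup_iff.1 a.2).1

theorem SU3_inv_coe (a : SU3) :
    ((a⁻¹ : SU3) : Matrix (Fin 3) (Fin 3) ℂ) = (a : Matrix (Fin 3) (Fin 3) ℂ)ᴴ := rfl

theorem cof_eq_transition_mulVec {q : P} (h : S.proj q ∈ σ.dom) (v : EuclideanSpace ℝ (Fin 6)) :
    S.cof q v = (transition σ q : Matrix (Fin 3) (Fin 3) ℂ) *ᵥ S.cof (σ.sec (S.proj q)) v := by
  rw [← act_transition σ h, cof_act, Matrix.mulVec_mulVec, SU3_inv_coe, SU3_mul_conjTranspose,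
    Matrix.one_mulVec]

/-- The entries of `transition σ`. -/
def transitionFun (q : P) (i j : Fin 3) : ℂ := (transition σ q : Matrix (Fin 3) (Fin 3) ℂ) i j

theorem of_transitionFun (q : P) :
    (Matrix.of (transitionFun σ q) : Matrix (Fin 3) (Fin 3) ℂ) = transition σ q := rfl

/-- The transition function `q ↦ coframe q ∘ σ (π q)⁻¹` is smooth, since the coframes are. -/
theorem contMDiffOn_transitionFun :
    ContMDiffOn (𝓡 14) 𝓘(ℝ, Fin 3 → Fin 3 → ℂ) ∞ (transitionFun σ) (S.domOver σ x₀) := by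
  intro q hq
  refine ContMDiffAt.contMDiffWithinAt ?_
  have hK : ∀ q ∈ S.proj ⁻¹' (chartAt (EuclideanSpace ℝ (Fin 6)) x₀).source,
      ContMDiffAt (𝓡 14) 𝓘(ℝ, EuclideanSpace ℝ (Fin 6) →L[ℝ] (Fin 3 → ℂ)) ∞ (S.chartCof x₀) q :=
    fun q hq => (S.contMDiffOn_chartCof x₀).contMDiffAt
      (((chartAt _ x₀).open_source.preimage S.contMDiff_proj.continuous).mem_nhds hq)
  have hsec : ContMDiffAt (𝓡 14) (𝓡 14) ∞ (fun q => σ.sec (S.proj q)) q :=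
    (σ.contMDiffOn_sec.contMDiffAt (σ.isOpen_dom.mem_nhds hq.1)).comp q
      S.contMDiff_proj.contMDiffAt
  have hKs : ContMDiffAt (𝓡 14) 𝓘(ℝ, EuclideanSpace ℝ (Fin 6) →L[ℝ] (Fin 3 → ℂ)) ∞
      (fun q => S.chartCof x₀ (σ.sec (S.proj q))) q := by
    refine ContMDiffAt.comp q (hK _ ?_) hsec
    change S.proj (σ.sec (S.proj q)) ∈ (chartAt (EuclideanSpace ℝ (Fin 6)) x₀).source
    rw [σ.proj_sec _ hq.1]
    exact hq.2
  have hinv : ∀ q ∈ S.domOver σ x₀, (S.chartCof x₀ (σ.sec (S.proj q))).IsInvertible := by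
    intro q hq
    have h1 : (S.cof (σ.sec (S.proj q))).IsInvertible := ⟨S.cofEquiv _, rfl⟩
    have h2 := isInvertible_mfderivWithin_extChartAt_symm (I := 𝓡 6) (x := x₀)
      (y := extChartAt (𝓡 6) x₀ (S.proj (σ.sec (S.proj q))))
      ((extChartAt (𝓡 6) x₀).map_source (by
        rw [σ.proj_sec _ hq.1, extChartAt_source]; exact hq.2))
    rw [ModelWithCorners.range_eq_univ, mfderivWithin_univ] at h2
    have h3 : (chartSymmDeriv x₀
      (extChartAt (𝓡 6) x₀ (S.proj (σ.sec (S.proj q))))).IsInvertible := h2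
    exact h1.comp h3
  have hKi : ContMDiffAt (𝓡 14) 𝓘(ℝ, (Fin 3 → ℂ) →L[ℝ] EuclideanSpace ℝ (Fin 6)) ∞
      (fun q => (S.chartCof x₀ (σ.sec (S.proj q))).inverse) q :=
    ((hinv q hq).contDiffAt_map_inverse (n := ∞)).contMDiffAt.comp q hKs
  have hprod : ContMDiffAt (𝓡 14) 𝓘(ℝ, (Fin 3 → ℂ) →L[ℝ] (Fin 3 → ℂ)) ∞
      (fun q => S.chartCof x₀ q ∘L (S.chartCof x₀ (σ.sec (S.proj q))).inverse) q :=
    (hK q hq.2).clm_comp hKi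
  let ev : ((Fin 3 → ℂ) →L[ℝ] (Fin 3 → ℂ)) →L[ℝ] (Fin 3 → Fin 3 → ℂ) :=
    ContinuousLinearMap.pi fun i => ContinuousLinearMap.pi fun j =>
      (ContinuousLinearMap.proj i : (Fin 3 → ℂ) →L[ℝ] ℂ) ∘L
        ContinuousLinearMap.apply ℝ (Fin 3 → ℂ) (Pi.single j (1 : ℂ))
  refine (ev.contDiff.contMDiff.contMDiffAt.comp q hprod).congr_of_eventuallyEq ?_
  filter_upwards [(isOpen_domOver σ x₀).mem_nhds hq] with q hq
  have hfac : S.chartCof x₀ q =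
      mulVecL (transitionFun σ q) ∘L S.chartCof x₀ (σ.sec (S.proj q)) := by
    ext1 v
    simp only [chartCof, ContinuousLinearMap.comp_apply, σ.proj_sec _ hq.1]
    rw [cof_eq_transition_mulVec σ hq.1]
    rfl
  ext i j
  change _ = (S.chartCof x₀ q ∘L (S.chartCof x₀ (σ.sec (S.proj q))).inverse) (Pi.single j (1 : ℂ)) i
  rw [hfac, ContinuousLinearMap.comp_assoc, (hinv q hq).self_comp_inverse]
  simp [mulVecL_apply, of_transitionFun, transitionFun]

/-- The projection `π` in the chart of `P` at `q₀` and the chart of `M` at `x₀`. -/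
def chartProj (S : SU3Structure M P) (x₀ : M) (q₀ : P) (z : EuclideanSpace ℝ (Fin 14)) :
    EuclideanSpace ℝ (Fin 6) :=
  extChartAt (𝓡 6) x₀ (S.proj ((extChartAt (𝓡 14) q₀).symm z))

theorem contMDiffAt_chart_symm {n : ℕ} {X : Type*} [TopologicalSpace X]
    [ChartedSpace (EuclideanSpace ℝ (Fin n)) X] [IsManifold (𝓡 n) ∞ X] (x : X)
    {y : EuclideanSpace ℝ (Fin n)} (hy : y ∈ (extChartAt (𝓡 n) x).target) :
    ContMDiffAt 𝓘(ℝ, EuclideanSpace ℝ (Fin n)) (𝓡 n) ∞ (extChartAt (𝓡 n) x).symm y :=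
  (contMDiffOn_extChartAt_symm x).contMDiffAt ((isOpen_extChartAt_target x).mem_nhds hy)

theorem contDiffAt_chartProj {q₀ : P} {z : EuclideanSpace ℝ (Fin 14)}
    (hz : z ∈ (extChartAt (𝓡 14) q₀).target)
    (hz' : S.proj ((extChartAt (𝓡 14) q₀).symm z) ∈
      (chartAt (EuclideanSpace ℝ (Fin 6)) x₀).source) :
    ContDiffAt ℝ ∞ (S.chartProj x₀ q₀) z := by
  rw [← contMDiffAt_iff_contDiffAt]
  have h2 : ContMDiffAt (𝓡 6) 𝓘(ℝ, EuclideanSpace ℝ (Fin 6)) ∞ (extChartAt (𝓡 6) x₀)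
      (S.proj ((extChartAt (𝓡 14) q₀).symm z)) := contMDiffAt_extChartAt' hz'
  exact (h2.comp _ S.contMDiff_proj.contMDiffAt).comp z (contMDiffAt_chart_symm q₀ hz)

theorem chartSymmDeriv_fderiv_chartProj {q₀ : P} {z : EuclideanSpace ℝ (Fin 14)}
    (hz : z ∈ (extChartAt (𝓡 14) q₀).target)
    (hz' : S.proj ((extChartAt (𝓡 14) q₀).symm z) ∈
      (chartAt (EuclideanSpace ℝ (Fin 6)) x₀).source)
    (v : EuclideanSpace ℝ (Fin 14)) :
    chartSymmDeriv x₀ (S.chartProj x₀ q₀ z) (fderiv ℝ (S.chartProj x₀ q₀) z v) =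
      S.dproj ((extChartAt (𝓡 14) q₀).symm z) (chartSymmDeriv q₀ z v) := by
  have hs : S.proj ((extChartAt (𝓡 14) q₀).symm z) ∈ (extChartAt (𝓡 6) x₀).source := by
    rwa [extChartAt_source]
  have hsm := contMDiffAt_chart_symm q₀ hz
  have h1 : HasMFDerivAt 𝓘(ℝ, EuclideanSpace ℝ (Fin 14)) (𝓡 6)
      (S.proj ∘ (extChartAt (𝓡 14) q₀).symm) z _ :=
    HasMFDerivAt.comp z
      (S.contMDiff_proj.mdifferentiable (by norm_num) _).hasMFDerivAt
      (hsm.mdifferentiableAt (by norm_num)).hasMFDerivAt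
  have h2 : HasMFDerivAt 𝓘(ℝ, EuclideanSpace ℝ (Fin 14)) 𝓘(ℝ, EuclideanSpace ℝ (Fin 6))
      (S.chartProj x₀ q₀) z (fderiv ℝ (S.chartProj x₀ q₀) z) :=
    ((contDiffAt_chartProj x₀ hz hz').differentiableAt (by norm_num)).hasFDerivAt.hasMFDerivAt
  have h3 : HasMFDerivAt 𝓘(ℝ, EuclideanSpace ℝ (Fin 14)) (𝓡 6)
      ((extChartAt (𝓡 6) x₀).symm ∘ S.chartProj x₀ q₀) z _ :=
    HasMFDerivAt.comp z ((contMDiffAt_chart_symm x₀ (y := S.chartProj x₀ q₀ z)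
      ((extChartAt (𝓡 6) x₀).map_source hs)).mdifferentiableAt (by norm_num)).hasMFDerivAt h2
  have hcont : ContinuousAt (fun z => S.proj ((extChartAt (𝓡 14) q₀).symm z)) z :=
    S.contMDiff_proj.continuous.continuousAt.comp hsm.continuousAt
  have hev : ((extChartAt (𝓡 6) x₀).symm ∘ S.chartProj x₀ q₀) =ᶠ[nhds z]
      S.proj ∘ (extChartAt (𝓡 14) q₀).symm := by
    filter_upwards [hcont.preimage_mem_nhds ((isOpen_extChartAt_source x₀).mem_nhds hs)] with w hw
    exact (extChartAt (𝓡 6) x₀).left_inv hw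
  have := hasMFDerivAt_unique h1 (h3.congr_of_eventuallyEq hev.symm)
  exact (DFunLike.congr_fun this v).symm

end SU3Structure

/-! ### The tautological form -/

theorem chartSymmDeriv_self {n : ℕ} {X : Type*} [TopologicalSpace X]
    [ChartedSpace (EuclideanSpace ℝ (Fin n)) X] [IsManifold (𝓡 n) ∞ X] (x : X)
    (v : EuclideanSpace ℝ (Fin n)) : chartSymmDeriv x (extChartAt (𝓡 n) x x) v = v := by
  have h := mfderivWithin_extChartAt_symm_comp_mfderiv_extChartAt' (I := 𝓡 n) (x := x)
    (mem_extChartAt_source (I := 𝓡 n) x)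
  rw [mfderiv_extChartAt_self, ModelWithCorners.range_eq_univ, mfderivWithin_univ] at h
  exact DFunLike.congr_fun h v

theorem fderiv_comp_chart_symm {n : ℕ} {X : Type*} [TopologicalSpace X]
    [ChartedSpace (EuclideanSpace ℝ (Fin n)) X] [IsManifold (𝓡 n) ∞ X] {x : X}
    {G : Type*} [NormedAddCommGroup G] [NormedSpace ℝ G] {f : X → G}
    {z : EuclideanSpace ℝ (Fin n)} (hz : z ∈ (extChartAt (𝓡 n) x).target)
    (hf : MDifferentiableAt (𝓡 n) 𝓘(ℝ, G) f ((extChartAt (𝓡 n) x).symm z))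
    (v : EuclideanSpace ℝ (Fin n)) :
    fderiv ℝ (fun z => f ((extChartAt (𝓡 n) x).symm z)) z v =
      (mfderiv (𝓡 n) 𝓘(ℝ, G) f ((extChartAt (𝓡 n) x).symm z) : EuclideanSpace ℝ (Fin n) →L[ℝ] G)
        (chartSymmDeriv x z v) := by
  have h := HasMFDerivAt.comp z hf.hasMFDerivAt
    ((SU3Structure.contMDiffAt_chart_symm x hz).mdifferentiableAt (by norm_num)).hasMFDerivAt
  have key : ∀ (A : EuclideanSpace ℝ (Fin n) →L[ℝ] G) (g : EuclideanSpace ℝ (Fin n) → G),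
      HasFDerivAt g (A ∘L chartSymmDeriv x z) z → fderiv ℝ g z v = A (chartSymmDeriv x z v) := by
    intro A g h
    rw [h.fderiv]
    rfl
  exact key _ _ (hasMFDerivAt_iff_hasFDerivAt.1 h)

theorem vol_mulVec (a : SU3) (x y z : Fin 3 → ℂ) :
    vol ((a : Matrix (Fin 3) (Fin 3) ℂ) *ᵥ x) ((a : Matrix (Fin 3) (Fin 3) ℂ) *ᵥ y)
      ((a : Matrix (Fin 3) (Fin 3) ℂ) *ᵥ z) = vol x y z := by
  have h := Psi0_mulVec a ![x, y, z]
  rw [Psi0_eq_vol, Psi0_eq_vol] at h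
  exact h

theorem dotProduct_mulVec_star (a : SU3) (x y : Fin 3 → ℂ) :
    ((a : Matrix (Fin 3) (Fin 3) ℂ) *ᵥ x) ⬝ᵥ star ((a : Matrix (Fin 3) (Fin 3) ℂ) *ᵥ y) =
      x ⬝ᵥ star y := by
  rw [mulVec_dotProduct_star, Matrix.mulVec_mulVec, SU3Structure.SU3_conjTranspose_mul,
    Matrix.one_mulVec, ← Matrix.star_dotProduct_star, star_star, dotProduct_comm]

namespace SU3Structure

variable {M : Type*} [TopologicalSpace M] [ChartedSpace (EuclideanSpace ℝ (Fin 6)) M]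
  [IsManifold (𝓡 6) ∞ M]
  {P : Type*} [TopologicalSpace P] [ChartedSpace (EuclideanSpace ℝ (Fin 14)) P]
  [IsManifold (𝓡 14) ∞ P] (S : SU3Structure M P)

/-- The tautological form `ω` as a `ℂ³`-valued linear map on the model space of `P`. -/
def taut (q : P) : EuclideanSpace ℝ (Fin 14) →L[ℝ] (Fin 3 → ℂ) := S.cof q ∘L S.dproj q

/-- The `ℂ³`-valued 2-form `dω`, as a function of two vectors of the model space of `P`. -/
def dtaut (q : P) (u v : EuclideanSpace ℝ (Fin 14)) (i : Fin 3) : ℂ :=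
  (mextDeriv (oneForm (S.tautForm i)) q : (Fin 2 → EuclideanSpace ℝ (Fin 14)) → ℂ) ![u, v]

theorem contMDiff_act_right (a : SU3) : ContMDiff (𝓡 14) (𝓡 14) ∞ (fun q => S.act q a) := by
  intro q
  have h := S.contMDiff_act 14 (extChartAt (𝓡 14) q).target (isOpen_extChartAt_target q)
    (extChartAt (𝓡 14) q).symm (fun _ => a) (contMDiffOn_extChartAt_symm q)
    (fun i j => contDiffOn_const)
  have h1 := (h.contMDiffAt ((isOpen_extChartAt_target q).mem_nhds
    (mem_extChartAt_target q))).comp q (contMDiffAt_extChartAt (n := ∞))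
  refine h1.congr_of_eventuallyEq ?_
  filter_upwards [extChartAt_source_mem_nhds (I := 𝓡 14) q] with p hp
  simp only [Function.comp_apply, (extChartAt (𝓡 14) q).left_inv hp]

/-- The derivative of the right translation by `a`. -/
def dact (a : SU3) (q : P) : EuclideanSpace ℝ (Fin 14) →L[ℝ] EuclideanSpace ℝ (Fin 14) :=
  mfderiv (𝓡 14) (𝓡 14) (fun q => S.act q a) q

theorem dproj_dact (a : SU3) (q : P) (v : EuclideanSpace ℝ (Fin 14)) :
    S.dproj (S.act q a) (S.dact a q v) = S.dproj q v := by
  have h1 : HasMFDerivAt (𝓡 14) (𝓡 6) (S.proj ∘ fun q => S.act q a) q _ :=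
    HasMFDerivAt.comp q (S.contMDiff_proj.mdifferentiable (by norm_num) _).hasMFDerivAt
      ((S.contMDiff_act_right a).mdifferentiable (by norm_num) q).hasMFDerivAt
  have e : (S.proj ∘ fun q => S.act q a) = S.proj := funext fun q => S.proj_act q a
  rw [e] at h1
  have h2 := hasMFDerivAt_unique h1
    (S.contMDiff_proj.mdifferentiable (by norm_num) q).hasMFDerivAt
  exact DFunLike.congr_fun h2 v

/-- The projection is a submersion: through every point of `P` there is a smooth local section,
namely a translate by the group of a given one. -/
theorem dproj_surjective (q : P) : Function.Surjective (S.dproj q) := by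
  obtain ⟨σ, hσ⟩ := S.exists_localSection (S.proj q)
  set x := S.proj q with hx
  have hsec : MDifferentiableAt (𝓡 6) (𝓡 14) σ.sec x :=
    (σ.contMDiffOn_sec.contMDiffAt (σ.isOpen_dom.mem_nhds hσ)).mdifferentiableAt (by norm_num)
  have h1 : HasMFDerivAt (𝓡 6) (𝓡 6) (S.proj ∘ σ.sec) x _ :=
    HasMFDerivAt.comp x (S.contMDiff_proj.mdifferentiable (by norm_num) _).hasMFDerivAt
      hsec.hasMFDerivAt
  have e : id =ᶠ[nhds x] S.proj ∘ σ.sec := by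
    filter_upwards [σ.isOpen_dom.mem_nhds hσ] with y hy
    exact (σ.proj_sec y hy).symm
  have h2 := hasMFDerivAt_unique (h1.congr_of_eventuallyEq e) (hasMFDerivAt_id x)
  have h3 : ∀ v : EuclideanSpace ℝ (Fin 6), S.dproj (σ.sec x)
      ((mfderiv (𝓡 6) (𝓡 14) σ.sec x : EuclideanSpace ℝ (Fin 6) →L[ℝ] EuclideanSpace ℝ (Fin 14)) v)
        = v := fun v => DFunLike.congr_fun h2 v
  intro v
  have hq : S.act (σ.sec x) (transition σ q)⁻¹ = q := by
    rw [← act_transition σ hσ, ← S.act_mul, mul_inv_cancel, S.act_one]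
  have h4 := S.dproj_dact (transition σ q)⁻¹ (σ.sec x)
    ((mfderiv (𝓡 6) (𝓡 14) σ.sec x : EuclideanSpace ℝ (Fin 6) →L[ℝ] EuclideanSpace ℝ (Fin 14)) v)
  rw [h3, hq] at h4
  exact ⟨_, h4⟩

theorem cof_bijective (q : P) : Function.Bijective (S.cof q) := (S.cofEquiv q).bijective

theorem taut_surjective (q : P) : Function.Surjective (S.taut q) :=
  (S.cof_bijective q).2.comp (S.dproj_surjective q)

variable {S}
variable (σ : S.LocalSection) (x₀ : M)

/-- The 2-form `dη` of the section `η`, read in the chart at `x₀`. -/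
def sectionCofD (y u v : EuclideanSpace ℝ (Fin 6)) : Fin 3 → ℂ :=
  fderiv ℝ (sectionCof σ x₀) y u v - fderiv ℝ (sectionCof σ x₀) y v u

/-- The derivative of the matrix valued function `transition σ`. -/
def transitionDeriv (q : P) : EuclideanSpace ℝ (Fin 14) →L[ℝ] (Fin 3 → Fin 3 → ℂ) :=
  mfderiv (𝓡 14) 𝓘(ℝ, Fin 3 → Fin 3 → ℂ) (transitionFun σ) q

/-- The derivative of `π` at `q`, read in the chart of `M` at `x₀`. -/
def baseDeriv (S : SU3Structure M P) (x₀ : M) (q : P) :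
    EuclideanSpace ℝ (Fin 14) →L[ℝ] EuclideanSpace ℝ (Fin 6) :=
  fderiv ℝ (S.chartProj x₀ q) (extChartAt (𝓡 14) q q)

theorem chartProj_self (q : P) :
    S.chartProj x₀ q (extChartAt (𝓡 14) q q) = extChartAt (𝓡 6) x₀ (S.proj q) := by
  simp [chartProj]

theorem fderiv_transitionFun_chart {q : P} {z : EuclideanSpace ℝ (Fin 14)}
    (hz : z ∈ (extChartAt (𝓡 14) q).target) (hz' : (extChartAt (𝓡 14) q).symm z ∈ S.domOver σ x₀)
    (v : EuclideanSpace ℝ (Fin 14)) :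
    fderiv ℝ (fun z => transitionFun σ ((extChartAt (𝓡 14) q).symm z)) z v =
      transitionDeriv σ ((extChartAt (𝓡 14) q).symm z) (chartSymmDeriv q z v) :=
  fderiv_comp_chart_symm hz (((contMDiffOn_transitionFun σ x₀).contMDiffAt
    ((isOpen_domOver σ x₀).mem_nhds hz')).mdifferentiableAt (by norm_num)) v

theorem transitionDeriv_eq {q : P} (hq : q ∈ S.domOver σ x₀) (v : EuclideanSpace ℝ (Fin 14)) :
    transitionDeriv σ q v = fderiv ℝ (fun z => transitionFun σ ((extChartAt (𝓡 14) q).symm z))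
      (extChartAt (𝓡 14) q q) v := by
  have := fderiv_transitionFun_chart σ x₀ (q := q) (mem_extChartAt_target q) (by simpa using hq) v
  rw [chartSymmDeriv_self, extChartAt_to_inv] at this
  exact this.symm

theorem contDiffAt_transitionFun_chart {q : P} {z : EuclideanSpace ℝ (Fin 14)}
    (hz : z ∈ (extChartAt (𝓡 14) q).target) (hz' : (extChartAt (𝓡 14) q).symm z ∈ S.domOver σ x₀) :
    ContDiffAt ℝ ∞ (fun z => transitionFun σ ((extChartAt (𝓡 14) q).symm z)) z := by
  rw [← contMDiffAt_iff_contDiffAt]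
  exact ((contMDiffOn_transitionFun σ x₀).contMDiffAt ((isOpen_domOver σ x₀).mem_nhds hz')).comp z
    (contMDiffAt_chart_symm q hz)

theorem eventually_mem_domOver {q : P} (hq : q ∈ S.domOver σ x₀) :
    ∀ᶠ z in nhds (extChartAt (𝓡 14) q q), z ∈ (extChartAt (𝓡 14) q).target ∧
      (extChartAt (𝓡 14) q).symm z ∈ S.domOver σ x₀ := by
  refine Filter.Eventually.and ((isOpen_extChartAt_target q).mem_nhds (mem_extChartAt_target q)) ?_
  have hc := continuousAt_extChartAt_symm (I := 𝓡 14) q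
  exact hc.preimage_mem_nhds ((isOpen_domOver σ x₀).mem_nhds (by simpa using hq))

/-- In charts, `ω = h η` with `h = transition σ`. -/
theorem taut_chart {q : P} {z : EuclideanSpace ℝ (Fin 14)}
    (hz : z ∈ (extChartAt (𝓡 14) q).target) (hz' : (extChartAt (𝓡 14) q).symm z ∈ S.domOver σ x₀)
    (v : EuclideanSpace ℝ (Fin 14)) :
    S.taut ((extChartAt (𝓡 14) q).symm z) (chartSymmDeriv q z v) =
      mulVecL (transitionFun σ ((extChartAt (𝓡 14) q).symm z))
        (sectionCof σ x₀ (S.chartProj x₀ q z) (fderiv ℝ (S.chartProj x₀ q) z v)) := by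
  have hs : S.proj ((extChartAt (𝓡 14) q).symm z) ∈ (extChartAt (𝓡 6) x₀).source := by
    rw [extChartAt_source]; exact hz'.2
  have e : (extChartAt (𝓡 6) x₀).symm (S.chartProj x₀ q z) =
      S.proj ((extChartAt (𝓡 14) q).symm z) := (extChartAt (𝓡 6) x₀).left_inv hs
  rw [sectionCof, e, chartCof, σ.proj_sec _ hz'.1, ContinuousLinearMap.comp_apply]
  have := chartSymmDeriv_fderiv_chartProj x₀ hz hz'.2 v
  rw [chartProj] at this
  rw [this, taut, ContinuousLinearMap.comp_apply, cof_eq_transition_mulVec σ hz'.1]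
  rfl

theorem taut_eq {q : P} (hq : q ∈ S.domOver σ x₀) (v : EuclideanSpace ℝ (Fin 14)) :
    S.taut q v = (transition σ q : Matrix (Fin 3) (Fin 3) ℂ) *ᵥ
      sectionCof σ x₀ (extChartAt (𝓡 6) x₀ (S.proj q)) (S.baseDeriv x₀ q v) := by
  have h := taut_chart σ x₀ (q := q) (mem_extChartAt_target q) (by simpa using hq) v
  rw [chartProj_self, chartSymmDeriv_self, extChartAt_to_inv] at h
  exact h

/-- The structure equation of the flat connection defined by a local section: with `ω = h η`,
one has `dω = (dh h⁻¹) ∧ ω + h dη`. -/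
theorem dtaut_eq {q : P} (hq : q ∈ S.domOver σ x₀) (u v : EuclideanSpace ℝ (Fin 14)) :
    S.dtaut q u v =
      matWedge (fun u => (Matrix.of (transitionDeriv σ q u) : Matrix (Fin 3) (Fin 3) ℂ) *
        (transition σ q : Matrix (Fin 3) (Fin 3) ℂ)ᴴ) (S.taut q) u v
      + (transition σ q : Matrix (Fin 3) (Fin 3) ℂ) *ᵥ
        sectionCofD σ x₀ (extChartAt (𝓡 6) x₀ (S.proj q)) (S.baseDeriv x₀ q u)
          (S.baseDeriv x₀ q v) := by
  have hq' : (extChartAt (𝓡 14) q).symm (extChartAt (𝓡 14) q q) = q := extChartAt_to_inv q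
  obtain ⟨D, hD, hD'⟩ := hasFDerivAt_mulVecL_comp (z := extChartAt (𝓡 14) q q)
    (η := sectionCof σ x₀) (f := S.chartProj x₀ q)
    (h := fun z => transitionFun σ ((extChartAt (𝓡 14) q).symm z))
    (by rw [chartProj_self]
        exact (contDiffAt_sectionCof σ x₀ hq.1 hq.2).differentiableAt (by norm_num))
    ((contDiffAt_chartProj x₀ (mem_extChartAt_target q) (by rw [hq']; exact hq.2)).of_le
      ENat.LEInfty.out)
    ((contDiffAt_transitionFun_chart σ x₀ (mem_extChartAt_target q)
      (by rwa [hq'])).differentiableAt (by norm_num))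
  have key : S.dtaut q u v = D u v - D v u := by
    ext i
    refine (mextDeriv_apply _ _ _).trans ?_
    refine (extDeriv_dz_comp i ?_ hD _).trans ?_
    rotate_left
    · rfl
    · filter_upwards [eventually_mem_domOver σ x₀ hq] with z hz
      ext w
      exact congrFun (taut_chart σ x₀ hz.1 hz.2 (w 0)) i
  rw [key, hD', ← transitionDeriv_eq σ x₀ hq, ← transitionDeriv_eq σ x₀ hq, chartProj_self, hq']
  have hm : ∀ u v, ((Matrix.of (transitionDeriv σ q u) : Matrix (Fin 3) (Fin 3) ℂ) *
        (transition σ q : Matrix (Fin 3) (Fin 3) ℂ)ᴴ) *ᵥ S.taut q v =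
      (Matrix.of (transitionDeriv σ q u) : Matrix (Fin 3) (Fin 3) ℂ) *ᵥ
        sectionCof σ x₀ (extChartAt (𝓡 6) x₀ (S.proj q)) (S.baseDeriv x₀ q v) := by
    intro u v
    rw [taut_eq σ x₀ hq, Matrix.mulVec_mulVec, Matrix.mul_assoc, SU3_conjTranspose_mul,
      Matrix.mul_one]
  simp only [matWedge, hm]
  rfl

end SU3Structure

/-! ### The nearly Calabi-Yau condition and the structure equations on the total space -/

theorem sum_epsilon (a b c : Fin 3 → ℂ) :
    ∑ j, ∑ k, ∑ l, a j * epsilon j k l * (b k * c l) = vol a b c := by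
  have h1 : vol a b c = (Matrix.of fun i j => ![a, b, c] j i : Matrix (Fin 3) (Fin 3) ℂ).det := by
    rw [vol_eq, Matrix.det_fin_three]
    simp
    ring
  rw [h1, Matrix.det_apply]
  simp only [epsilon, Finset.mul_sum, Finset.sum_mul]
  have h2 : ∀ F : Fin 3 → Fin 3 → Fin 3 → Equiv.Perm (Fin 3) → ℂ,
      ∑ j, ∑ k, ∑ l, ∑ σ, F j k l σ = ∑ σ, ∑ j, ∑ k, ∑ l, F j k l σ := by
    intro F
    simp only [Finset.sum_comm (s := (Finset.univ : Finset (Fin 3)))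
      (t := (Finset.univ : Finset (Equiv.Perm (Fin 3))))]
  rw [h2]
  refine Finset.sum_congr rfl fun σ _ => ?_
  rw [Finset.sum_eq_single (σ 0), Finset.sum_eq_single (σ 1), Finset.sum_eq_single (σ 2)]
  · simp [Fin.prod_univ_three, Units.smul_def]
    ring
  all_goals
    first
    | exact fun h => absurd (Finset.mem_univ _) h
    | (intro j; simp +contextual [eq_comm])

namespace SU3Structure

variable {M : Type*} [TopologicalSpace M] [ChartedSpace (EuclideanSpace ℝ (Fin 6)) M]
  [IsManifold (𝓡 6) ∞ M]
  {P : Type*} [TopologicalSpace P] [ChartedSpace (EuclideanSpace ℝ (Fin 14)) P]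
  [IsManifold (𝓡 14) ∞ P] {S : SU3Structure M P}

section Closed

variable (σ : S.LocalSection) (x₀ : M)

/-- The form `dh h⁻¹`, with `h = transition σ`, has values in `𝔰𝔲(3)`. -/
theorem special_unitary_transitionDeriv {q : P} (hq : q ∈ S.domOver σ x₀)
    (u : EuclideanSpace ℝ (Fin 14)) :
    ((Matrix.of (transitionDeriv σ q u) : Matrix (Fin 3) (Fin 3) ℂ) *
        (transition σ q : Matrix (Fin 3) (Fin 3) ℂ)ᴴ)ᴴ =
      -((Matrix.of (transitionDeriv σ q u) : Matrix (Fin 3) (Fin 3) ℂ) *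
        (transition σ q : Matrix (Fin 3) (Fin 3) ℂ)ᴴ) ∧
    ((Matrix.of (transitionDeriv σ q u) : Matrix (Fin 3) (Fin 3) ℂ) *
        (transition σ q : Matrix (Fin 3) (Fin 3) ℂ)ᴴ).trace = 0 := by
  have hq' : (extChartAt (𝓡 14) q).symm (extChartAt (𝓡 14) q q) = q := extChartAt_to_inv q
  have h := special_unitary_deriv (z := extChartAt (𝓡 14) q q)
    (g := fun z => transitionFun σ ((extChartAt (𝓡 14) q).symm z))
    ((contDiffAt_transitionFun_chart σ x₀ (mem_extChartAt_target q)
      (by rwa [hq'])).differentiableAt (by norm_num))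
    (Filter.Eventually.of_forall fun z => (transition σ _).2) u
  rw [← transitionDeriv_eq σ x₀ hq, hq'] at h
  exact h

/-- `d (Ω₀ (ω, ω))` is computed by `dη` for any section `η`: in the structure equation of the flat
connection the `𝔰𝔲(3)`-valued term does not contribute. -/
theorem hermWedge_dtaut_im {q : P} (hq : q ∈ S.domOver σ x₀) (u v w : EuclideanSpace ℝ (Fin 14)) :
    (hermWedge (S.dtaut q) (S.taut q) u v w).im =
      (hermWedge (sectionCofD σ x₀ (extChartAt (𝓡 6) x₀ (S.proj q)))
        (sectionCof σ x₀ (extChartAt (𝓡 6) x₀ (S.proj q))) (S.baseDeriv x₀ q u)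
        (S.baseDeriv x₀ q v) (S.baseDeriv x₀ q w)).im := by
  have e : S.dtaut q = fun u v => _ := funext fun u => funext fun v => dtaut_eq σ x₀ hq u v
  rw [e, hermWedge_add (matWedge _ _), Complex.add_im, hermWedge_matWedge_im
    (fun v => (special_unitary_transitionDeriv σ x₀ hq v).1), zero_add]
  simp only [hermWedge, taut_eq σ x₀ hq, dotProduct_mulVec_star]

theorem volWedge_dtaut {q : P} (hq : q ∈ S.domOver σ x₀) (u v w z : EuclideanSpace ℝ (Fin 14)) :
    volWedge (S.dtaut q) (S.taut q) u v w z =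
      volWedge (sectionCofD σ x₀ (extChartAt (𝓡 6) x₀ (S.proj q)))
        (sectionCof σ x₀ (extChartAt (𝓡 6) x₀ (S.proj q))) (S.baseDeriv x₀ q u)
        (S.baseDeriv x₀ q v) (S.baseDeriv x₀ q w) (S.baseDeriv x₀ q z) := by
  have e : S.dtaut q = fun u v => _ := funext fun u => funext fun v => dtaut_eq σ x₀ hq u v
  rw [e, volWedge_add (matWedge _ _), volWedge_matWedge]
  simp only [(special_unitary_transitionDeriv σ x₀ hq _).2]
  simp only [volWedge, taut_eq σ x₀ hq, vol_mulVec]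
  ring

theorem sectionCof_chart {x : M} {y : EuclideanSpace ℝ (Fin 6)}
    (hy : y ∈ (extChartAt (𝓡 6) x).target) (hy' : (extChartAt (𝓡 6) x).symm y ∈ σ.dom)
    (v : EuclideanSpace ℝ (Fin 6)) :
    sectionCof σ x y v = S.cof (σ.sec ((extChartAt (𝓡 6) x).symm y)) (chartSymmDeriv x y v) := by
  rw [sectionCof, chartCof, σ.proj_sec _ hy', (extChartAt (𝓡 6) x).right_inv hy]
  rfl

theorem mextDeriv_Omega {x : M} (hx : x ∈ σ.dom) (v : Fin 3 → EuclideanSpace ℝ (Fin 6)) :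
    (mextDeriv S.Omega x : (Fin 3 → EuclideanSpace ℝ (Fin 6)) → ℂ) v =
      ((-(hermWedge (sectionCofD σ x (extChartAt (𝓡 6) x x))
        (sectionCof σ x (extChartAt (𝓡 6) x x)) (v 0) (v 1) (v 2)).im : ℝ) : ℂ) := by
  refine (mextDeriv_apply _ _ _).trans (extDeriv_Omega0_comp (Θ := sectionCof σ x) ?_
    ((contDiffAt_sectionCof σ x hx (mem_chart_source _ x)).differentiableAt
      (by norm_num)).hasFDerivAt v)
  filter_upwards [(isOpen_extChartAt_target x).mem_nhds (mem_extChartAt_target x),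
    (continuousAt_extChartAt_symm (I := 𝓡 6) x).preimage_mem_nhds
      (σ.isOpen_dom.mem_nhds (by simpa using hx))] with y hy hy'
  have h := S.Omega_eq _ _ (σ.proj_sec _ hy')
  ext w
  refine (DFunLike.congr_fun h (fun i => chartSymmDeriv x y (w i))).trans ?_
  change Omega0 _ = Omega0 _
  congr 1
  funext i
  exact (sectionCof_chart σ hy hy' (w i)).symm

theorem mextDeriv_imPsi {x : M} (hx : x ∈ σ.dom) (v : Fin 4 → EuclideanSpace ℝ (Fin 6)) :
    (mextDeriv S.imPsi x : (Fin 4 → EuclideanSpace ℝ (Fin 6)) → ℝ) v =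
      (volWedge (sectionCofD σ x (extChartAt (𝓡 6) x x))
        (sectionCof σ x (extChartAt (𝓡 6) x x)) (v 0) (v 1) (v 2) (v 3)).im := by
  refine (mextDeriv_apply _ _ _).trans (extDeriv_im_Psi0_comp (Θ := sectionCof σ x) ?_
    ((contDiffAt_sectionCof σ x hx (mem_chart_source _ x)).differentiableAt
      (by norm_num)).hasFDerivAt v)
  filter_upwards [(isOpen_extChartAt_target x).mem_nhds (mem_extChartAt_target x),
    (continuousAt_extChartAt_symm (I := 𝓡 6) x).preimage_mem_nhds
      (σ.isOpen_dom.mem_nhds (by simpa using hx))] with y hy hy'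
  have h := S.imPsi_eq _ _ (σ.proj_sec _ hy')
  ext w
  refine (DFunLike.congr_fun h (fun i => chartSymmDeriv x y (w i))).trans ?_
  change (Psi0 _).im = (Psi0 _).im
  congr 2
  funext i
  exact (sectionCof_chart σ hy hy' (w i)).symm

end Closed

theorem baseDeriv_eq_dproj (q : P) (v : EuclideanSpace ℝ (Fin 14)) :
    S.baseDeriv (S.proj q) q v = S.dproj q v := by
  have h := chartSymmDeriv_fderiv_chartProj (S := S) (S.proj q) (q₀ := q) (mem_extChartAt_target q)
    (by rw [extChartAt_to_inv]; exact mem_chart_source _ _) v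
  rw [chartProj_self, chartSymmDeriv_self, chartSymmDeriv_self, extChartAt_to_inv] at h
  exact h

/-- The nearly Calabi-Yau condition in terms of `dω` on `P`. -/
theorem isNearlyCalabiYau_iff : S.IsNearlyCalabiYau ↔
    (∀ q u v w, (hermWedge (S.dtaut q) (S.taut q) u v w).im = 0) ∧
    (∀ q u v w z, (volWedge (S.dtaut q) (S.taut q) u v w z).im = 0) := by
  refine and_congr ⟨fun h q u v w => ?_, fun h x => ?_⟩ ⟨fun h q u v w z => ?_, fun h x => ?_⟩
  · obtain ⟨σ, hσ⟩ := S.exists_localSection (S.proj q)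
    rw [hermWedge_dtaut_im σ (S.proj q) ⟨hσ, mem_chart_source _ _⟩]
    have h1 := mextDeriv_Omega σ hσ ![S.baseDeriv (S.proj q) q u, S.baseDeriv (S.proj q) q v,
      S.baseDeriv (S.proj q) q w]
    rw [h] at h1
    have h2 := h1.symm
    change _ = (0 : ℂ) at h2
    rw [Complex.ofReal_eq_zero, neg_eq_zero] at h2
    exact h2
  · obtain ⟨q, rfl⟩ := S.exists_proj_eq x
    obtain ⟨σ, hσ⟩ := S.exists_localSection (S.proj q)
    ext v
    refine (mextDeriv_Omega σ hσ v).trans ?_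
    obtain ⟨u0, hu0⟩ := S.dproj_surjective q (v 0)
    obtain ⟨u1, hu1⟩ := S.dproj_surjective q (v 1)
    obtain ⟨u2, hu2⟩ := S.dproj_surjective q (v 2)
    have h1 := h q u0 u1 u2
    rw [hermWedge_dtaut_im σ (S.proj q) ⟨hσ, mem_chart_source _ _⟩, baseDeriv_eq_dproj,
      baseDeriv_eq_dproj, baseDeriv_eq_dproj, hu0, hu1, hu2] at h1
    exact (congrArg (fun r : ℝ => ((-r : ℝ) : ℂ)) h1).trans (by simp)
  · obtain ⟨σ, hσ⟩ := S.exists_localSection (S.proj q)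
    rw [volWedge_dtaut σ (S.proj q) ⟨hσ, mem_chart_source _ _⟩]
    have h1 := mextDeriv_imPsi σ hσ ![S.baseDeriv (S.proj q) q u, S.baseDeriv (S.proj q) q v,
      S.baseDeriv (S.proj q) q w, S.baseDeriv (S.proj q) q z]
    rw [h] at h1
    exact h1.symm
  · obtain ⟨q, rfl⟩ := S.exists_proj_eq x
    obtain ⟨σ, hσ⟩ := S.exists_localSection (S.proj q)
    ext v
    refine (mextDeriv_imPsi σ hσ v).trans ?_
    obtain ⟨u0, hu0⟩ := S.dproj_surjective q (v 0)
    obtain ⟨u1, hu1⟩ := S.dproj_surjective q (v 1)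
    obtain ⟨u2, hu2⟩ := S.dproj_surjective q (v 2)
    obtain ⟨u3, hu3⟩ := S.dproj_surjective q (v 3)
    have h1 := h q u0 u1 u2 u3
    rw [volWedge_dtaut σ (S.proj q) ⟨hσ, mem_chart_source _ _⟩, baseDeriv_eq_dproj,
      baseDeriv_eq_dproj, baseDeriv_eq_dproj, baseDeriv_eq_dproj, hu0, hu1, hu2, hu3] at h1
    exact h1

/-- The structure equations, evaluated on vectors. -/
theorem structureEquations_iff {α : Fin 3 → Fin 3 → ∀ p : P, TangentSpace (𝓡 14) p →L[ℝ] ℂ}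
    {N : P → Matrix (Fin 3) (Fin 3) ℂ} : S.StructureEquations α N ↔
    ∀ q (u v : EuclideanSpace ℝ (Fin 14)), S.dtaut q u v =
      -matWedge (formMatrix α q : EuclideanSpace ℝ (Fin 14) → _) (S.taut q) u v
        + torsionTerm (N q) (S.taut q) u v := by
  have key : ∀ (q : P) (i : Fin 3) (v : Fin 2 → TangentSpace (𝓡 14) q),
      (-(∑ j, wedge ![α i j q, S.tautForm j q]) +
        (1 / 2 : ℂ) • ∑ j, ∑ k, ∑ l, (N q i j * epsilon j k l) •
          wedge ![conjForm (S.tautForm k q), conjForm (S.tautForm l q)]) v =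
      (-matWedge (formMatrix α q : EuclideanSpace ℝ (Fin 14) → _) (S.taut q) (v 0) (v 1)
        + torsionTerm (N q) (S.taut q) (v 0) (v 1)) i := by
    intro q i v
    have e1 : ∀ j, wedge ![α i j q, S.tautForm j q] v =
        α i j q (v 0) * S.taut q (v 1) j - α i j q (v 1) * S.taut q (v 0) j := by
      intro j
      rw [wedge_apply, Matrix.det_fin_two]
      rfl
    have e2 : ∀ k l, wedge ![conjForm (S.tautForm k q), conjForm (S.tautForm l q)] v =
        star (S.taut q (v 0)) k * star (S.taut q (v 1)) l
          - star (S.taut q (v 1)) k * star (S.taut q (v 0)) l := by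
      intro k l
      rw [wedge_apply, Matrix.det_fin_two]
      rfl
    have e3 : (torsionTerm (N q) (S.taut q) (v 0) (v 1)) i =
        vol (N q i) (star (S.taut q (v 0))) (star (S.taut q (v 1))) := rfl
    have e4 : (torsionTerm (N q) (S.taut q) (v 0) (v 1)) i = (1 / 2 : ℂ) *
        (vol (N q i) (star (S.taut q (v 0))) (star (S.taut q (v 1)))
          - vol (N q i) (star (S.taut q (v 1))) (star (S.taut q (v 0)))) := by
      rw [e3]
      simp only [vol_eq]
      ring
    rw [Pi.add_apply, e4, ← sum_epsilon, ← sum_epsilon]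
    simp only [ContinuousAlternatingMap.add_apply, ContinuousAlternatingMap.neg_apply,
      ContinuousAlternatingMap.sum_apply, ContinuousAlternatingMap.smul_apply, e1, e2]
    simp only [smul_eq_mul, mul_sub, Finset.sum_sub_distrib]
    rfl
  constructor
  · intro h q u v
    ext i
    refine (DFunLike.congr_fun (h q i) (![u, v] : Fin 2 → EuclideanSpace ℝ (Fin 14))).trans ?_
    exact key q i (![u, v] : Fin 2 → EuclideanSpace ℝ (Fin 14))
  · intro h q i
    ext v
    rw [key]
    have h1 := congrFun (h q (v 0) (v 1)) i
    have e : v = (![v 0, v 1] : Fin 2 → EuclideanSpace ℝ (Fin 14)) := by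
      funext j
      fin_cases j <;> rfl
    refine Eq.trans ?_ h1
    exact congrArg (fun w : Fin 2 → EuclideanSpace ℝ (Fin 14) =>
      (mextDeriv (oneForm (S.tautForm i)) q : (Fin 2 → EuclideanSpace ℝ (Fin 14)) → ℂ) w) e

end SU3Structure

/-! ### The connection form of a local section -/

theorem star_mulVec_cross_star_mulVec (h : SU3) (x y : Fin 3 → ℂ) :
    star ((h : Matrix (Fin 3) (Fin 3) ℂ) *ᵥ x) ⨯₃ star ((h : Matrix (Fin 3) (Fin 3) ℂ) *ᵥ y) =
      (h : Matrix (Fin 3) (Fin 3) ℂ) *ᵥ (star x ⨯₃ star y) := by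
  -- both sides have the same products with the vectors `h w̄`
  have key : ∀ w, (((h : Matrix (Fin 3) (Fin 3) ℂ) *ᵥ w) ⬝ᵥ
      (((h : Matrix (Fin 3) (Fin 3) ℂ) *ᵥ x) ⨯₃ ((h : Matrix (Fin 3) (Fin 3) ℂ) *ᵥ y))) =
      ((h : Matrix (Fin 3) (Fin 3) ℂ) *ᵥ w) ⬝ᵥ
        star ((h : Matrix (Fin 3) (Fin 3) ℂ) *ᵥ (star x ⨯₃ star y)) := by
    intro w
    rw [dotProduct_mulVec_star, star_cross_star, star_star]
    exact vol_mulVec h w x y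
  rw [star_cross_star]
  apply star_injective
  rw [star_star]
  ext i
  have := key ((h : Matrix (Fin 3) (Fin 3) ℂ)ᴴ *ᵥ Pi.single i 1)
  rw [Matrix.mulVec_mulVec, SU3Structure.SU3_mul_conjTranspose, Matrix.one_mulVec] at this
  simpa using this

namespace SU3Structure

variable {M : Type*} [TopologicalSpace M] [ChartedSpace (EuclideanSpace ℝ (Fin 6)) M]
  [IsManifold (𝓡 6) ∞ M]
  {P : Type*} [TopologicalSpace P] [ChartedSpace (EuclideanSpace ℝ (Fin 14)) P]
  [IsManifold (𝓡 14) ∞ P] {S : SU3Structure M P}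
  (σ : S.LocalSection) (x₀ : M)

/-- The torsion `dη (η⁻¹ ·, η⁻¹ ·)` of a section `η`, as a bilinear map on `ℂ³`. It is meaningful
at the points `y` of the chart over the domain of the section, where `η` is invertible. -/
def sectionTorsion (y : EuclideanSpace ℝ (Fin 6)) :
    (Fin 3 → ℂ) →ₗ[ℝ] (Fin 3 → ℂ) →ₗ[ℝ] (Fin 3 → ℂ) :=
  LinearMap.mk₂ ℝ (fun a b => sectionCofD σ x₀ y ((sectionCof σ x₀ y).inverse a)
      ((sectionCof σ x₀ y).inverse b))
    (by intro a b c; simp only [sectionCofD, map_add, add_apply]; abel)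
    (by intro a b c; simp only [sectionCofD, map_smul, smul_apply, smul_sub])
    (by intro a b c; simp only [sectionCofD, map_add, add_apply]; abel)
    (by intro a b c; simp only [sectionCofD, map_smul, smul_apply, smul_sub])

/-- The skew-Hermitian matrix valued form `β` on `M` which absorbs the torsion of the section,
evaluated at the vector `η⁻¹ (w)`. -/
def sectionConn (y : EuclideanSpace ℝ (Fin 6)) (w : Fin 3 → ℂ) : Matrix (Fin 3) (Fin 3) ℂ :=
  torsionConn (fun a b => sectionTorsion σ x₀ y a b) w

/-- The value of the form `- dh h⁻¹ + h β h⁻¹`, where `h = transition σ` and `β` is the form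
`sectionConn` on the base which absorbs the torsion of the section. -/
def localConn (q : P) (u : EuclideanSpace ℝ (Fin 14)) : Matrix (Fin 3) (Fin 3) ℂ :=
  -((Matrix.of (transitionDeriv σ q u) : Matrix (Fin 3) (Fin 3) ℂ) *
      (transition σ q : Matrix (Fin 3) (Fin 3) ℂ)ᴴ)
    + (transition σ q : Matrix (Fin 3) (Fin 3) ℂ) *
      sectionConn σ x₀ (extChartAt (𝓡 6) x₀ (S.proj q))
        (S.cof (σ.sec (S.proj q)) (S.dproj q u)) *
      (transition σ q : Matrix (Fin 3) (Fin 3) ℂ)ᴴ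

theorem sectionCof_baseDeriv {q : P} (hq : q ∈ S.domOver σ x₀) (u : EuclideanSpace ℝ (Fin 14)) :
    sectionCof σ x₀ (extChartAt (𝓡 6) x₀ (S.proj q)) (S.baseDeriv x₀ q u) =
      S.cof (σ.sec (S.proj q)) (S.dproj q u) := by
  have h1 := taut_eq σ x₀ hq u
  rw [taut, ContinuousLinearMap.comp_apply, cof_eq_transition_mulVec σ hq.1] at h1
  have h2 := congrArg (fun x => (transition σ q : Matrix (Fin 3) (Fin 3) ℂ)ᴴ *ᵥ x) h1
  simp only [Matrix.mulVec_mulVec, SU3_conjTranspose_mul, Matrix.one_mulVec] at h2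
  exact h2.symm

theorem isInvertible_sectionCof {x : M} (hx : x ∈ σ.dom)
    (hx' : x ∈ (chartAt (EuclideanSpace ℝ (Fin 6)) x₀).source) :
    (sectionCof σ x₀ (extChartAt (𝓡 6) x₀ x)).IsInvertible := by
  have hs : x ∈ (extChartAt (𝓡 6) x₀).source := by rwa [extChartAt_source]
  have h1 : (S.cof (σ.sec x)).IsInvertible := ⟨S.cofEquiv _, rfl⟩
  have h2 := isInvertible_mfderivWithin_extChartAt_symm (I := 𝓡 6) (x := x₀)
    (y := extChartAt (𝓡 6) x₀ x) ((extChartAt (𝓡 6) x₀).map_source hs)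
  rw [ModelWithCorners.range_eq_univ, mfderivWithin_univ] at h2
  have h3 : (chartSymmDeriv x₀ (extChartAt (𝓡 6) x₀ x)).IsInvertible := h2
  have e : sectionCof σ x₀ (extChartAt (𝓡 6) x₀ x) =
      S.cof (σ.sec x) ∘L chartSymmDeriv x₀ (extChartAt (𝓡 6) x₀ x) := by
    rw [sectionCof, (extChartAt (𝓡 6) x₀).left_inv hs, chartCof, σ.proj_sec _ hx]
  rw [e]
  exact h1.comp h3

theorem sectionConn_add (y : EuclideanSpace ℝ (Fin 6)) (v w : Fin 3 → ℂ) :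
    sectionConn σ x₀ y (v + w) = sectionConn σ x₀ y v + sectionConn σ x₀ y w :=
  torsionConn_add _ v w

theorem sectionConn_smul (y : EuclideanSpace ℝ (Fin 6)) (c : ℝ) (w : Fin 3 → ℂ) :
    sectionConn σ x₀ y (c • w) = c • sectionConn σ x₀ y w :=
  torsionConn_smul _ c w

/-- The structure equation `dη = - β ∧ η + N (η̄ × η̄)` of the section, pulled back to `P`. -/
theorem exists_sectionTorsion
    (h1 : ∀ q u v w, (hermWedge (S.dtaut q) (S.taut q) u v w).im = 0)
    (h2 : ∀ q u v w z, (volWedge (S.dtaut q) (S.taut q) u v w z).im = 0)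
    {q : P} (hq : q ∈ S.domOver σ x₀) :
    (∀ w, (sectionConn σ x₀ (extChartAt (𝓡 6) x₀ (S.proj q)) w).trace = 0) ∧
      ∃ N : Matrix (Fin 3) (Fin 3) ℂ, N.IsHermitian ∧ N.trace = 0 ∧ ∀ u v,
        sectionCofD σ x₀ (extChartAt (𝓡 6) x₀ (S.proj q)) (S.baseDeriv x₀ q u)
          (S.baseDeriv x₀ q v) =
        -matWedge (sectionConn σ x₀ (extChartAt (𝓡 6) x₀ (S.proj q))) id
            (S.cof (σ.sec (S.proj q)) (S.dproj q u)) (S.cof (σ.sec (S.proj q)) (S.dproj q v))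
          + torsionTerm N id
            (S.cof (σ.sec (S.proj q)) (S.dproj q u)) (S.cof (σ.sec (S.proj q)) (S.dproj q v)) := by
  set y := extChartAt (𝓡 6) x₀ (S.proj q) with hy
  have hinv := isInvertible_sectionCof σ x₀ hq.1 hq.2
  rw [← hy] at hinv
  have e1 : ∀ u, (sectionCof σ x₀ y).inverse (sectionCof σ x₀ y u) = u := fun u =>
    DFunLike.congr_fun hinv.inverse_comp_self u
  have hsurj : Function.Surjective fun u => sectionCof σ x₀ y (S.baseDeriv x₀ q u) := by
    intro a
    simp only [hy, sectionCof_baseDeriv σ x₀ hq]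
    obtain ⟨v, hv⟩ := (S.cof_bijective (σ.sec (S.proj q))).2 a
    obtain ⟨u, hu⟩ := S.dproj_surjective q v
    exact ⟨u, by rw [hu, hv]⟩
  obtain ⟨htr, N, hN, hN0, hN1⟩ := exists_torsion (sectionTorsion σ x₀ y)
    (by intro a; simp [sectionTorsion, sectionCofD])
    (by
      intro a b c
      obtain ⟨u, rfl⟩ := hsurj a
      obtain ⟨v, rfl⟩ := hsurj b
      obtain ⟨w, rfl⟩ := hsurj c
      have := h1 q u v w
      rw [hermWedge_dtaut_im σ x₀ hq, ← hy] at this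
      simpa only [hermWedge, sectionTorsion, LinearMap.mk₂_apply, e1, id] using this)
    (by
      intro a b c d
      obtain ⟨u, rfl⟩ := hsurj a
      obtain ⟨v, rfl⟩ := hsurj b
      obtain ⟨w, rfl⟩ := hsurj c
      obtain ⟨z, rfl⟩ := hsurj d
      have := h2 q u v w z
      rw [volWedge_dtaut σ x₀ hq, ← hy] at this
      simpa only [volWedge, sectionTorsion, LinearMap.mk₂_apply, e1, id] using this)
  refine ⟨htr, N, hN, hN0, fun u v => ?_⟩
  have := hN1 (S.cof (σ.sec (S.proj q)) (S.dproj q u)) (S.cof (σ.sec (S.proj q)) (S.dproj q v))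
  refine Eq.trans ?_ this
  rw [← sectionCof_baseDeriv σ x₀ hq, ← sectionCof_baseDeriv σ x₀ hq]
  simp only [sectionTorsion, LinearMap.mk₂_apply, ← hy, e1]

/-- The form `localConn` has values in `𝔰𝔲(3)` and satisfies the structure equations. -/
theorem localConn_structure
    (h1 : ∀ q u v w, (hermWedge (S.dtaut q) (S.taut q) u v w).im = 0)
    (h2 : ∀ q u v w z, (volWedge (S.dtaut q) (S.taut q) u v w z).im = 0)
    {q : P} (hq : q ∈ S.domOver σ x₀) :
    (∀ u, (localConn σ x₀ q u).trace = 0) ∧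
      ∃ N : Matrix (Fin 3) (Fin 3) ℂ, N.IsHermitian ∧ N.trace = 0 ∧ ∀ u v,
        S.dtaut q u v = -matWedge (localConn σ x₀ q) (S.taut q) u v
          + torsionTerm N (S.taut q) u v := by
  obtain ⟨htr, N, hN, hN0, hN1⟩ := exists_sectionTorsion σ x₀ h1 h2 hq
  set h := (transition σ q : Matrix (Fin 3) (Fin 3) ℂ) with hh
  have hhh : hᴴ * h = 1 := SU3_conjTranspose_mul _
  refine ⟨fun u => ?_, h * N * hᴴ, Matrix.isHermitian_mul_mul_conjTranspose _ hN, ?_, fun u v => ?_⟩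
  · rw [localConn, Matrix.trace_add, Matrix.trace_neg,
      (special_unitary_transitionDeriv σ x₀ hq u).2,
      Matrix.trace_mul_cycle, ← hh, hhh, Matrix.one_mul, htr]
    simp
  · rw [Matrix.trace_mul_cycle, hhh, Matrix.one_mul, hN0]
  · have ht : ∀ u, S.taut q u = h *ᵥ S.cof (σ.sec (S.proj q)) (S.dproj q u) := fun u =>
      cof_eq_transition_mulVec σ hq.1 _
    have hL : ∀ u x, localConn σ x₀ q u *ᵥ (h *ᵥ x) =
        -((Matrix.of (transitionDeriv σ q u) : Matrix (Fin 3) (Fin 3) ℂ) *ᵥ x)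
        + h *ᵥ (sectionConn σ x₀ (extChartAt (𝓡 6) x₀ (S.proj q))
          (S.cof (σ.sec (S.proj q)) (S.dproj q u)) *ᵥ x) := by
      intro u x
      simp only [localConn, ← hh, Matrix.mulVec_mulVec, Matrix.add_mul, Matrix.neg_mul,
        Matrix.mul_assoc, hhh, Matrix.mul_one, Matrix.add_mulVec, Matrix.neg_mulVec]
    have hX : ∀ x y, star (h *ᵥ x) ⨯₃ star (h *ᵥ y) = h *ᵥ (star x ⨯₃ star y) :=
      star_mulVec_cross_star_mulVec (transition σ q)
    have hT : ∀ x, (h * N * hᴴ) *ᵥ (h *ᵥ x) = h *ᵥ (N *ᵥ x) := by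
      intro x
      rw [Matrix.mulVec_mulVec, Matrix.mulVec_mulVec, Matrix.mul_assoc, hhh, Matrix.mul_one]
    have hD : ∀ u x, ((Matrix.of (transitionDeriv σ q u) : Matrix (Fin 3) (Fin 3) ℂ) * hᴴ) *ᵥ
        (h *ᵥ x) = (Matrix.of (transitionDeriv σ q u) : Matrix (Fin 3) (Fin 3) ℂ) *ᵥ x := by
      intro u x
      rw [Matrix.mulVec_mulVec, Matrix.mul_assoc, hhh, Matrix.mul_one]
    rw [dtaut_eq σ x₀ hq, hN1]
    simp only [matWedge, torsionTerm, id, ht, hL, hX, hT, hD, ← hh, Matrix.mulVec_add,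
      Matrix.mulVec_neg, Matrix.mulVec_sub]
    abel

theorem localConn_conjTranspose {q : P} (hq : q ∈ S.domOver σ x₀) (u : EuclideanSpace ℝ (Fin 14)) :
    (localConn σ x₀ q u)ᴴ = -localConn σ x₀ q u := by
  rw [localConn, Matrix.conjTranspose_add, Matrix.conjTranspose_neg,
    (special_unitary_transitionDeriv σ x₀ hq u).1, Matrix.conjTranspose_mul,
    Matrix.conjTranspose_mul, Matrix.conjTranspose_conjTranspose, sectionConn,
    torsionConn_conjTranspose, Matrix.neg_mul, Matrix.mul_neg, Matrix.mul_assoc]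
  abel

/-- The entries of `localConn` as linear forms. -/
def localConnForm (i j : Fin 3) (q : P) : EuclideanSpace ℝ (Fin 14) →L[ℝ] ℂ :=
  LinearMap.toContinuousLinearMap
    { toFun := fun u => localConn σ x₀ q u i j
      map_add' := fun u v => by
        simp only [localConn, map_add, ← Matrix.of_add_of, sectionConn_add, Matrix.add_mul,
          Matrix.mul_add, Matrix.add_apply, Matrix.neg_apply]
        ring
      map_smul' := fun c u => by
        simp only [localConn, map_smul, ← Matrix.smul_of, sectionConn_smul, Matrix.smul_mul,
          Matrix.mul_smul, Matrix.add_apply, Matrix.neg_apply, Matrix.smul_apply, RingHom.id_apply,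
          smul_add,
          smul_neg] }

end SU3Structure

/-! ### Smoothness -/

theorem contDiffAt_of_clm_apply {E F G : Type*} [NormedAddCommGroup E] [NormedSpace ℝ E]
    [NormedAddCommGroup F] [NormedSpace ℝ F] [FiniteDimensional ℝ F] [NormedAddCommGroup G]
    [NormedSpace ℝ G] {f : E → F →L[ℝ] G} {z : E} (h : ∀ v, ContDiffAt ℝ ∞ (fun y => f y v) z) :
    ContDiffAt ℝ ∞ f z := by
  let d := Module.finrank ℝ F
  have hd : d = Module.finrank ℝ (Fin d → ℝ) := (Module.finrank_fin_fun ℝ).symm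
  let e₁ := ContinuousLinearEquiv.ofFinrankEq hd
  let e₂ := (e₁.arrowCongr (1 : G ≃L[ℝ] G)).trans (ContinuousLinearEquiv.piRing (Fin d))
  rw [← Function.id_comp f, ← e₂.symm_comp_self]
  exact e₂.symm.contDiff.contDiffAt.comp z (contDiffAt_pi.2 fun i => h _)

/-- A 1-form is smooth if its coefficients in the preferred charts are. -/
theorem isSmoothOneForm_of_chart {n : ℕ} {X : Type*} [TopologicalSpace X]
    [ChartedSpace (EuclideanSpace ℝ (Fin n)) X] [IsManifold (𝓡 n) ∞ X]
    (θ : ∀ x : X, TangentSpace (𝓡 n) x →L[ℝ] ℂ)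
    (h : ∀ x : X, ∀ v : EuclideanSpace ℝ (Fin n), ContDiffAt ℝ ∞
      (fun z : EuclideanSpace ℝ (Fin n) =>
        (θ ((extChartAt (𝓡 n) x).symm z) : EuclideanSpace ℝ (Fin n) → ℂ) (chartSymmDeriv x z v))
      (extChartAt (𝓡 n) x x)) : IsSmoothOneForm θ := by
  intro x
  rw [contMDiffAt_hom_bundle]
  refine ⟨contMDiffAt_id, ?_⟩
  have h1 : ContDiffAt ℝ ∞ (fun z : EuclideanSpace ℝ (Fin n) =>
      ((show EuclideanSpace ℝ (Fin n) →L[ℝ] ℂ from θ ((extChartAt (𝓡 n) x).symm z)) ∘L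
        chartSymmDeriv x z)) (extChartAt (𝓡 n) x x) :=
    contDiffAt_of_clm_apply (h x)
  have h2 := h1.contMDiffAt.comp x (contMDiffAt_extChartAt (n := ∞))
  refine h2.congr_of_eventuallyEq ?_
  filter_upwards [(chartAt (EuclideanSpace ℝ (Fin n)) x).open_source.mem_nhds
    (mem_chart_source (EuclideanSpace ℝ (Fin n)) x)] with x' hx'
  have hs : x' ∈ (extChartAt (𝓡 n) x).source := by rwa [extChartAt_source]
  have e1 : ∀ v : EuclideanSpace ℝ (Fin n), ((trivializationAt (EuclideanSpace ℝ (Fin n))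
      (TangentSpace (𝓡 n)) x).symmL ℝ x' v : EuclideanSpace ℝ (Fin n)) =
      chartSymmDeriv x (extChartAt (𝓡 n) x x') v := fun v => symmL_apply_eq hx' v
  have e2 : ∀ w, (trivializationAt ℂ (Bundle.Trivial X ℂ) x).continuousLinearMapAt
      ℝ x' w = w := fun w => DFunLike.congr_fun
    (Bundle.Trivial.continuousLinearMapAt_trivialization ℝ X ℂ x') w
  ext1 v
  change _ = (θ ((extChartAt (𝓡 n) x).symm (extChartAt (𝓡 n) x x')) :
    EuclideanSpace ℝ (Fin n) → ℂ) (chartSymmDeriv x (extChartAt (𝓡 n) x x') v)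
  rw [← e1, (extChartAt (𝓡 n) x).left_inv hs]
  exact e2 _

theorem contDiffAt_torsionConn {E : Type*} [NormedAddCommGroup E] [NormedSpace ℝ E]
    {T : E → (Fin 3 → ℂ) → (Fin 3 → ℂ) → Fin 3 → ℂ} {w : E → Fin 3 → ℂ} {z : E}
    (hw : ContDiffAt ℝ ∞ w z)
    (hT : ∀ (a : Fin 3 → ℂ) (b : E → Fin 3 → ℂ), ContDiffAt ℝ ∞ b z →
      ContDiffAt ℝ ∞ (fun y => T y a (b y)) z) (i j : Fin 3) :
    ContDiffAt ℝ ∞ (fun y => torsionConn (T y) (w y) i j) z := by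
  have hIw : ContDiffAt ℝ ∞ (fun y => Complex.I • w y) z := hw.const_smul Complex.I
  have hm : ∀ i j, ContDiffAt ℝ ∞ (fun y => mixedPart (T y) (w y) i j) z := by
    intro i j
    have h := fun a => contDiffAt_pi.1 (hT a w hw) i
    have h' := fun a => contDiffAt_pi.1 (hT a _ hIw) i
    exact contDiffAt_const.mul ((((h _).sub (contDiffAt_const.mul (h _))).add
      (contDiffAt_const.mul (h' _))).add (h' _))
  exact (hm i j).sub (Complex.conjCLE.contDiff.contDiffAt.comp z (hm j i))

namespace SU3Structure

variable {M : Type*} [TopologicalSpace M] [ChartedSpace (EuclideanSpace ℝ (Fin 6)) M]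
  [IsManifold (𝓡 6) ∞ M]
  {P : Type*} [TopologicalSpace P] [ChartedSpace (EuclideanSpace ℝ (Fin 14)) P]
  [IsManifold (𝓡 14) ∞ P] {S : SU3Structure M P}
  (σ : S.LocalSection) (x₀ : M)

theorem contDiffAt_sectionTorsion {x : M} (hx : x ∈ σ.dom)
    (hx' : x ∈ (chartAt (EuclideanSpace ℝ (Fin 6)) x₀).source)
    {E : Type*} [NormedAddCommGroup E] [NormedSpace ℝ E] {f : E → EuclideanSpace ℝ (Fin 6)}
    {z : E} (hf : ContDiffAt ℝ ∞ f z) (hfz : f z = extChartAt (𝓡 6) x₀ x) {a b : E → Fin 3 → ℂ}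
    (ha : ContDiffAt ℝ ∞ a z) (hb : ContDiffAt ℝ ∞ b z) :
    ContDiffAt ℝ ∞ (fun y => sectionTorsion σ x₀ (f y) (a y) (b y)) z := by
  have h0 : ContDiffAt ℝ ∞ (sectionCof σ x₀) (f z) := by
    rw [hfz]; exact contDiffAt_sectionCof σ x₀ hx hx'
  have hinv : (sectionCof σ x₀ (f z)).IsInvertible := by
    rw [hfz]; exact isInvertible_sectionCof σ x₀ hx hx'
  have hi : ContDiffAt ℝ ∞ (fun y => (sectionCof σ x₀ (f y)).inverse) z :=
    ContDiffAt.comp (g := ContinuousLinearMap.inverse) z hinv.contDiffAt_map_inverse (h0.comp z hf)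
  have hd : ContDiffAt ℝ ∞ (fun y => fderiv ℝ (sectionCof σ x₀) (f y)) z :=
    (h0.fderiv_right (m := ∞) (by norm_num)).comp z hf
  exact ((hd.clm_apply (hi.clm_apply ha)).clm_apply (hi.clm_apply hb)).sub
    ((hd.clm_apply (hi.clm_apply hb)).clm_apply (hi.clm_apply ha))

theorem contDiffAt_localConn {q : P} (hq : q ∈ S.domOver σ x₀) (v : EuclideanSpace ℝ (Fin 14))
    (i j : Fin 3) :
    ContDiffAt ℝ ∞ (fun z => localConn σ x₀ ((extChartAt (𝓡 14) q).symm z)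
      (chartSymmDeriv q z v) i j) (extChartAt (𝓡 14) q q) := by
  set ψ := extChartAt (𝓡 14) q with hψ
  set h : EuclideanSpace ℝ (Fin 14) → Fin 3 → Fin 3 → ℂ :=
    fun z => transitionFun σ (ψ.symm z) with hh
  set w : EuclideanSpace ℝ (Fin 14) → Fin 3 → ℂ := fun z =>
    sectionCof σ x₀ (S.chartProj x₀ q z) (fderiv ℝ (S.chartProj x₀ q) z v) with hw
  have hsm : ContDiffAt ℝ ∞ h (ψ q) := contDiffAt_transitionFun_chart σ x₀
    (mem_extChartAt_target q) (by rw [hψ, extChartAt_to_inv]; exact hq)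
  have hsm' : ∀ i j, ContDiffAt ℝ ∞ (fun z => h z i j) (ψ q) := fun i j =>
    contDiffAt_pi.1 (contDiffAt_pi.1 hsm i) j
  have hstar : ∀ i j, ContDiffAt ℝ ∞ (fun z => star (h z i j)) (ψ q) := fun i j =>
    Complex.conjCLE.contDiff.contDiffAt.comp _ (hsm' i j)
  have hdh : ∀ i j, ContDiffAt ℝ ∞ (fun z => fderiv ℝ h z v i j) (ψ q) := fun i j =>
    contDiffAt_pi.1 (contDiffAt_pi.1
      ((hsm.fderiv_right (m := ∞) (by norm_num)).clm_apply contDiffAt_const) i) j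
  have hproj : ContDiffAt ℝ ∞ (S.chartProj x₀ q) (ψ q) :=
    contDiffAt_chartProj x₀ (mem_extChartAt_target q) (by rw [hψ, extChartAt_to_inv]; exact hq.2)
  have hwsm : ContDiffAt ℝ ∞ w (ψ q) := by
    have h0 : ContDiffAt ℝ ∞ (sectionCof σ x₀) (S.chartProj x₀ q (ψ q)) := by
      rw [chartProj_self]; exact contDiffAt_sectionCof σ x₀ hq.1 hq.2
    exact (h0.comp _ hproj).clm_apply
      ((hproj.fderiv_right (m := ∞) (by norm_num)).clm_apply contDiffAt_const)
  have hβ : ∀ i j, ContDiffAt ℝ ∞ (fun z => sectionConn σ x₀ (S.chartProj x₀ q z) (w z) i j)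
      (ψ q) := fun i j => contDiffAt_torsionConn hwsm
    (fun a b hb => contDiffAt_sectionTorsion σ x₀ hq.1 hq.2 hproj (chartProj_self x₀ q)
      contDiffAt_const hb) i j
  have hF : ContDiffAt ℝ ∞ (fun z => -(∑ k, fderiv ℝ h z v i k * star (h z j k)) +
      ∑ k, (∑ l, h z i l * sectionConn σ x₀ (S.chartProj x₀ q z) (w z) l k) * star (h z j k))
      (ψ q) :=
    (ContDiffAt.sum fun k _ => (hdh i k).mul (hstar j k)).neg.add
      (ContDiffAt.sum fun k _ => (ContDiffAt.sum fun l _ => (hsm' i l).mul (hβ l k)).mul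
        (hstar j k))
  refine hF.congr_of_eventuallyEq ?_
  filter_upwards [eventually_mem_domOver σ x₀ hq] with z hz
  have e1 := fderiv_transitionFun_chart σ x₀ hz.1 hz.2 v
  have e2 : w z = S.cof (σ.sec (S.proj (ψ.symm z)))
      (S.dproj (ψ.symm z) (chartSymmDeriv q z v)) := by
    have h1 := taut_chart σ x₀ hz.1 hz.2 v
    rw [taut, ContinuousLinearMap.comp_apply, cof_eq_transition_mulVec σ hz.2.1, mulVecL_apply,
      of_transitionFun] at h1
    have h2 := congrArg (fun x => (transition σ (ψ.symm z) : Matrix (Fin 3) (Fin 3) ℂ)ᴴ *ᵥ x) h1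
    simp only [hψ, Matrix.mulVec_mulVec, SU3_conjTranspose_mul, Matrix.one_mulVec] at h2
    exact h2.symm
  rw [hh, e1, e2]
  rfl

end SU3Structure

/-! ### Equivariance and values on vertical vectors -/

namespace SU3Structure

variable {M : Type*} [TopologicalSpace M] [ChartedSpace (EuclideanSpace ℝ (Fin 6)) M]
  [IsManifold (𝓡 6) ∞ M]
  {P : Type*} [TopologicalSpace P] [ChartedSpace (EuclideanSpace ℝ (Fin 14)) P]
  [IsManifold (𝓡 14) ∞ P] {S : SU3Structure M P}

section Local

variable (σ : S.LocalSection) (x₀ : M)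

theorem transition_act {p : P} (hp : S.proj p ∈ σ.dom) (a : SU3) :
    (transition σ (S.act p a) : Matrix (Fin 3) (Fin 3) ℂ) =
      (a : Matrix (Fin 3) (Fin 3) ℂ)ᴴ * (transition σ p : Matrix (Fin 3) (Fin 3) ℂ) := by
  refine Matrix.ext_of_mulVec_single fun i => ?_
  obtain ⟨v, hv⟩ := (S.cof_bijective (σ.sec (S.proj p))).2 (Pi.single i 1)
  have hpa : S.proj (S.act p a) ∈ σ.dom := by rwa [S.proj_act]
  have h1 := cof_eq_transition_mulVec σ hpa v
  rw [S.proj_act, cof_act, cof_eq_transition_mulVec σ hp, hv, Matrix.mulVec_mulVec] at h1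
  exact h1.symm

theorem hasMFDerivAt_transitionFun {q : P} (hq : q ∈ S.domOver σ x₀) :
    HasMFDerivAt (𝓡 14) 𝓘(ℝ, Fin 3 → Fin 3 → ℂ) (transitionFun σ) q (transitionDeriv σ q) :=
  (((contMDiffOn_transitionFun σ x₀).contMDiffAt
    ((isOpen_domOver σ x₀).mem_nhds hq)).mdifferentiableAt (by norm_num)).hasMFDerivAt

theorem act_mem_domOver {q : P} (hq : q ∈ S.domOver σ x₀) (a : SU3) :
    S.act q a ∈ S.domOver σ x₀ := by
  change S.proj (S.act q a) ∈ σ.dom ∩ (chartAt (EuclideanSpace ℝ (Fin 6)) x₀).source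
  rw [S.proj_act]
  exact hq

theorem transitionDeriv_dact {q : P} (hq : q ∈ S.domOver σ x₀) (a : SU3)
    (v : EuclideanSpace ℝ (Fin 14)) :
    (Matrix.of (transitionDeriv σ (S.act q a) (S.dact a q v)) : Matrix (Fin 3) (Fin 3) ℂ) =
      (a : Matrix (Fin 3) (Fin 3) ℂ)ᴴ *
        (Matrix.of (transitionDeriv σ q v) : Matrix (Fin 3) (Fin 3) ℂ) := by
  let l : (Fin 3 → Fin 3 → ℂ) →L[ℝ] (Fin 3 → Fin 3 → ℂ) := LinearMap.toContinuousLinearMap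
    { toFun := fun A => (a : Matrix (Fin 3) (Fin 3) ℂ)ᴴ * (Matrix.of A : Matrix (Fin 3) (Fin 3) ℂ)
      map_add' := fun A B => Matrix.mul_add (a : Matrix (Fin 3) (Fin 3) ℂ)ᴴ
        (Matrix.of A) (Matrix.of B)
      map_smul' := fun c A => Matrix.mul_smul (a : Matrix (Fin 3) (Fin 3) ℂ)ᴴ c (Matrix.of A) }
  have h1 : HasMFDerivAt (𝓡 14) 𝓘(ℝ, Fin 3 → Fin 3 → ℂ)
      (transitionFun σ ∘ fun q => S.act q a) q _ :=
    HasMFDerivAt.comp q (hasMFDerivAt_transitionFun σ x₀ (act_mem_domOver σ x₀ hq a))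
      ((S.contMDiff_act_right a).mdifferentiable (by norm_num) q).hasMFDerivAt
  have h2 : HasMFDerivAt (𝓡 14) 𝓘(ℝ, Fin 3 → Fin 3 → ℂ) (l ∘ transitionFun σ) q _ :=
    HasMFDerivAt.comp q l.hasMFDerivAt (hasMFDerivAt_transitionFun σ x₀ hq)
  have h3 := hasMFDerivAt_unique h1 (h2.congr_of_eventuallyEq (by
    filter_upwards [(isOpen_domOver σ x₀).mem_nhds hq] with p hp
    exact transition_act σ hp.1 a))
  exact DFunLike.congr_fun h3 v

theorem localConn_dact {q : P} (hq : q ∈ S.domOver σ x₀) (a : SU3)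
    (v : EuclideanSpace ℝ (Fin 14)) :
    localConn σ x₀ (S.act q a) (S.dact a q v) =
      (a : Matrix (Fin 3) (Fin 3) ℂ)ᴴ * localConn σ x₀ q v * (a : Matrix (Fin 3) (Fin 3) ℂ) := by
  rw [localConn, transitionDeriv_dact σ x₀ hq, transition_act σ hq.1, S.dproj_dact, S.proj_act,
    localConn, Matrix.conjTranspose_mul, Matrix.conjTranspose_conjTranspose]
  simp only [Matrix.mul_assoc, Matrix.mul_add, Matrix.add_mul, Matrix.mul_neg, Matrix.neg_mul]

theorem contMDiff_act_curve (p : P) {g : ℝ → SU3}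
    (hg : ∀ i j, ContDiff ℝ ∞ (fun t => (g t : Matrix (Fin 3) (Fin 3) ℂ) i j)) :
    ContMDiff 𝓘(ℝ, ℝ) (𝓡 14) ∞ (fun t => S.act p (g t)) := by
  have h1 := S.contMDiff_act 1 Set.univ isOpen_univ (fun _ => p) (fun z => g (z 0))
    contMDiffOn_const (fun i j => ((hg i j).comp (contDiff_euclidean.1 contDiff_id 0)).contDiffOn)
  have h2 : ContDiff ℝ ∞ (fun t : ℝ => (!₂[t] : EuclideanSpace ℝ (Fin 1))) :=
    contDiff_euclidean.2 fun i => by fin_cases i; exact contDiff_id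
  exact (contMDiffOn_univ.1 h1).comp h2.contMDiff

/-- On the velocity of `t ↦ p · g (t)` only the term `- dh h⁻¹` contributes. -/
theorem localConn_vertical {p : P} {g : ℝ → SU3} (hg0 : g 0 = 1)
    (hg : ∀ i j, ContDiff ℝ ∞ (fun t => (g t : Matrix (Fin 3) (Fin 3) ℂ) i j))
    (hp : S.act p (g 0) ∈ S.domOver σ x₀) (i j : Fin 3) :
    localConn σ x₀ (S.act p (g 0))
        (mfderiv 𝓘(ℝ, ℝ) (𝓡 14) (fun t : ℝ => S.act p (g t)) 0 (1 : ℝ)) i j =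
      deriv (fun t => (g t : Matrix (Fin 3) (Fin 3) ℂ) i j) 0 := by
  set h := (transition σ p : Matrix (Fin 3) (Fin 3) ℂ) with hh
  have hp' : S.proj p ∈ σ.dom := by
    have := hp.1
    rwa [S.proj_act] at this
  set c : ℝ → P := fun t => S.act p (g t) with hc
  set c' : EuclideanSpace ℝ (Fin 14) := mfderiv 𝓘(ℝ, ℝ) (𝓡 14) c 0 (1 : ℝ) with hc'
  have hcd : HasMFDerivAt 𝓘(ℝ, ℝ) (𝓡 14) c 0 (mfderiv 𝓘(ℝ, ℝ) (𝓡 14) c 0) :=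
    ((contMDiff_act_curve p hg).mdifferentiable (by norm_num) 0).hasMFDerivAt
  -- `c` is vertical
  have hv : S.dproj (S.act p (g 0)) c' = 0 := by
    have h1 : HasMFDerivAt 𝓘(ℝ, ℝ) (𝓡 6) (S.proj ∘ c) 0 _ :=
      HasMFDerivAt.comp 0 (S.contMDiff_proj.mdifferentiable (by norm_num) _).hasMFDerivAt hcd
    have e : S.proj ∘ c = fun _ => S.proj p := funext fun t => S.proj_act p (g t)
    rw [e] at h1
    exact DFunLike.congr_fun (hasMFDerivAt_unique h1 (hasMFDerivAt_const _ _)) (1 : ℝ)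
  -- along `c`, `transition σ` is `g (t)⁻¹ h`
  set G : ℝ → Fin 3 → Fin 3 → ℂ := fun t i j => (g t : Matrix (Fin 3) (Fin 3) ℂ) i j with hG
  have hGd : DifferentiableAt ℝ G 0 := differentiableAt_pi.2 fun i => differentiableAt_pi.2 fun j =>
    (hg i j).differentiable (by norm_num) 0
  let l : (Fin 3 → Fin 3 → ℂ) →L[ℝ] (Fin 3 → Fin 3 → ℂ) := LinearMap.toContinuousLinearMap
    { toFun := fun A => (Matrix.of A : Matrix (Fin 3) (Fin 3) ℂ)ᴴ * h
      map_add' := fun A B => by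
        rw [← Matrix.of_add_of, Matrix.conjTranspose_add, Matrix.add_mul]; rfl
      map_smul' := fun r A => by
        rw [← Matrix.smul_of, Matrix.conjTranspose_smul, star_trivial, Matrix.smul_mul]; rfl }
  have ht : (Matrix.of (transitionDeriv σ (S.act p (g 0)) c') : Matrix (Fin 3) (Fin 3) ℂ) =
      (Matrix.of (fderiv ℝ G 0 1) : Matrix (Fin 3) (Fin 3) ℂ)ᴴ * h := by
    have h1 : HasMFDerivAt 𝓘(ℝ, ℝ) 𝓘(ℝ, Fin 3 → Fin 3 → ℂ) (transitionFun σ ∘ c) 0 _ :=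
      HasMFDerivAt.comp 0 (hasMFDerivAt_transitionFun σ x₀ hp) hcd
    have e : transitionFun σ ∘ c = l ∘ G := funext fun t => transition_act σ hp' (g t)
    rw [e] at h1
    have h2 := (l.hasFDerivAt.comp (0 : ℝ) hGd.hasFDerivAt).hasMFDerivAt
    exact DFunLike.congr_fun (hasMFDerivAt_unique h1 h2) (1 : ℝ)
  have hz : sectionConn σ x₀ (extChartAt (𝓡 6) x₀ (S.proj (S.act p (g 0)))) 0 = 0 := by
    have := sectionConn_smul σ x₀ (extChartAt (𝓡 6) x₀ (S.proj (S.act p (g 0)))) 0 0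
    rwa [zero_smul, zero_smul] at this
  have hs := (special_unitary_deriv hGd (Filter.Eventually.of_forall fun t => (g t).2) 1).1
  have hG0 : (Matrix.of (G 0) : Matrix (Fin 3) (Fin 3) ℂ) = 1 := by
    change (g 0 : Matrix (Fin 3) (Fin 3) ℂ) = 1
    rw [hg0]
    rfl
  rw [hG0, Matrix.conjTranspose_one, Matrix.mul_one] at hs
  have hd : deriv (fun t => (g t : Matrix (Fin 3) (Fin 3) ℂ) i j) 0 = fderiv ℝ G 0 1 i j := by
    have := (hasFDerivAt_pi'.1 (hasFDerivAt_pi'.1 hGd.hasFDerivAt i) j).hasDerivAt.deriv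
    exact this
  have hm : localConn σ x₀ (S.act p (g 0)) c' = Matrix.of (fderiv ℝ G 0 1) := by
    rw [localConn, ht, hv, map_zero, hz, transition_act σ hp', hg0, ← hh]
    have e1 : ((1 : SU3) : Matrix (Fin 3) (Fin 3) ℂ) = 1 := rfl
    rw [e1, Matrix.conjTranspose_one, Matrix.one_mul, Matrix.mul_assoc, hh,
      SU3_mul_conjTranspose, hs]
    simp
  rw [hm, hd]
  rfl

end Local

/-! ### The connection of a nearly Calabi-Yau structure -/

section Global

theorem localConn_sub (σ : S.LocalSection) (x₀ : M) (q : P) (u v : EuclideanSpace ℝ (Fin 14)) :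
    localConn σ x₀ q (u - v) = localConn σ x₀ q u - localConn σ x₀ q v := by
  ext i j
  exact map_sub (localConnForm σ x₀ i j q) u v

/-- The local forms agree on overlaps, by the uniqueness of the solutions of the structure
equations. -/
theorem localConn_eq_localConn (h : S.IsNearlyCalabiYau) {σ σ' : S.LocalSection} {x₀ x₀' : M}
    {q : P} (hq : q ∈ S.domOver σ x₀) (hq' : q ∈ S.domOver σ' x₀')
    (u : EuclideanSpace ℝ (Fin 14)) : localConn σ x₀ q u = localConn σ' x₀' q u := by
  obtain ⟨h1, h2⟩ := isNearlyCalabiYau_iff.1 h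
  obtain ⟨-, N, -, -, hN⟩ := localConn_structure σ x₀ h1 h2 hq
  obtain ⟨-, N', -, -, hN'⟩ := localConn_structure σ' x₀' h1 h2 hq'
  exact eq_of_matWedge_add_torsionTerm (S.taut_surjective q) (map_sub (S.taut q))
    (localConn_conjTranspose σ x₀ hq) (localConn_conjTranspose σ' x₀' hq') (localConn_sub σ x₀ q)
    (localConn_sub σ' x₀' q) (fun u v => (hN u v).symm.trans (hN' u v)) u

variable (S) in
/-- A local section around a given point. -/
def sectionAt (x : M) : S.LocalSection := (S.exists_localSection x).choose

theorem mem_domOver_sectionAt (q : P) : q ∈ S.domOver (S.sectionAt (S.proj q)) (S.proj q) :=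
  ⟨(S.exists_localSection (S.proj q)).choose_spec, mem_chart_source _ _⟩

variable (S) in
/-- The connection form of a nearly Calabi-Yau structure: at each point it is the form `localConn`
defined by a local section. Only for nearly Calabi-Yau structures is it independent of the choice
of the sections, and then it is given near each point by a single one. -/
def canonicalConn (i j : Fin 3) (q : P) : TangentSpace (𝓡 14) q →L[ℝ] ℂ :=
  localConnForm (S.sectionAt (S.proj q)) (S.proj q) i j q

theorem formMatrix_canonicalConn (h : S.IsNearlyCalabiYau) {σ : S.LocalSection} {x₀ : M} {q : P}
    (hq : q ∈ S.domOver σ x₀) (u : EuclideanSpace ℝ (Fin 14)) :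
    formMatrix S.canonicalConn q u = localConn σ x₀ q u :=
  localConn_eq_localConn h (mem_domOver_sectionAt q) hq u

theorem isSmoothOneForm_canonicalConn (h : S.IsNearlyCalabiYau) (i j : Fin 3) :
    IsSmoothOneForm (S.canonicalConn i j) := by
  refine isSmoothOneForm_of_chart _ fun q v => ?_
  have hq := mem_domOver_sectionAt (S := S) q
  refine (contDiffAt_localConn _ _ hq v i j).congr_of_eventuallyEq ?_
  filter_upwards [eventually_mem_domOver _ _ hq] with z hz
  exact congrFun (congrFun (formMatrix_canonicalConn h hz.2 (chartSymmDeriv q z v)) i) j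

theorem isConnection_canonicalConn (h : S.IsNearlyCalabiYau) :
    S.IsConnection S.canonicalConn where
  smooth := isSmoothOneForm_canonicalConn h
  skewHermitian q v := localConn_conjTranspose _ _ (mem_domOver_sectionAt q) v
  trace_zero q v := by
    obtain ⟨h1, h2⟩ := isNearlyCalabiYau_iff.1 h
    exact (localConn_structure _ _ h1 h2 (mem_domOver_sectionAt q)).1 v
  vertical p g hg0 hg i j := localConn_vertical _ _ hg0 hg (mem_domOver_sectionAt _) i j
  equivariant a p v := by
    have hp := mem_domOver_sectionAt (S := S) p
    refine (formMatrix_canonicalConn h (act_mem_domOver _ _ hp a) _).trans ?_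
    exact localConn_dact _ _ hp a v

theorem isNearlyCalabiYauConnection_canonicalConn (h : S.IsNearlyCalabiYau) :
    S.IsNearlyCalabiYauConnection S.canonicalConn := by
  obtain ⟨h1, h2⟩ := isNearlyCalabiYau_iff.1 h
  choose N hN hN0 hs using fun q : P =>
    (localConn_structure _ _ h1 h2 (mem_domOver_sectionAt q)).2
  exact ⟨isConnection_canonicalConn h, N, structureEquations_iff.2 hs, fun q => ⟨hN q, hN0 q⟩⟩

theorem IsNearlyCalabiYauConnection.isNearlyCalabiYau
    {α : Fin 3 → Fin 3 → ∀ p : P, TangentSpace (𝓡 14) p →L[ℝ] ℂ}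
    (h : S.IsNearlyCalabiYauConnection α) : S.IsNearlyCalabiYau := by
  obtain ⟨hα, N, hs, hN⟩ := h
  rw [structureEquations_iff] at hs
  have key : ∀ q, ∃ K : EuclideanSpace ℝ (Fin 14) → Matrix (Fin 3) (Fin 3) ℂ,
      (∀ u, (K u)ᴴ = -K u) ∧ (∀ u, (K u).trace = 0) ∧
      S.dtaut q = fun u v => matWedge K (S.taut q) u v + torsionTerm (N q) (S.taut q) u v := by
    intro q
    refine ⟨fun u => -formMatrix α q u, fun u => ?_, fun u => ?_, ?_⟩
    · exact (Matrix.conjTranspose_neg _).trans (congrArg Neg.neg (hα.skewHermitian q u))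
    · exact (Matrix.trace_neg _).trans (neg_eq_zero.2 (hα.trace_zero q u))
    · funext u v
      rw [hs]
      simp only [matWedge, Matrix.neg_mulVec]
      abel
  refine isNearlyCalabiYau_iff.2 ⟨fun q u v w => ?_, fun q u v w z => ?_⟩
  · obtain ⟨K, hK, -, hs'⟩ := key q
    rw [hs', hermWedge_add, Complex.add_im, hermWedge_matWedge_im hK, hermWedge_torsionTerm,
      (hN q).2, zero_mul, Complex.zero_im, add_zero]
  · obtain ⟨K, -, hK, hs'⟩ := key q
    rw [hs', volWedge_add, Complex.add_im, volWedge_torsionTerm_im (hN q).1, volWedge_matWedge]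
    simp only [hK, zero_mul, sub_zero, add_zero, Complex.zero_im]

theorem IsNearlyCalabiYauConnection.unique
    {α α' : Fin 3 → Fin 3 → ∀ p : P, TangentSpace (𝓡 14) p →L[ℝ] ℂ}
    (h : S.IsNearlyCalabiYauConnection α) (h' : S.IsNearlyCalabiYauConnection α') : α = α' := by
  obtain ⟨hα, N, hs, -⟩ := h
  obtain ⟨hα', N', hs', -⟩ := h'
  rw [structureEquations_iff] at hs hs'
  have hsub : ∀ (α : Fin 3 → Fin 3 → ∀ p : P, TangentSpace (𝓡 14) p →L[ℝ] ℂ) (q : P)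
      (u v : EuclideanSpace ℝ (Fin 14)),
      (formMatrix α q : EuclideanSpace ℝ (Fin 14) → Matrix (Fin 3) (Fin 3) ℂ) (u - v) =
        (formMatrix α q : EuclideanSpace ℝ (Fin 14) → _) u
          - (formMatrix α q : EuclideanSpace ℝ (Fin 14) → _) v := by
    intro α q u v
    ext i j
    exact map_sub (α i j q) u v
  funext i j q
  ext u
  have := eq_of_matWedge_add_torsionTerm (S.taut_surjective q) (map_sub (S.taut q))
    (hα.skewHermitian q) (hα'.skewHermitian q) (hsub α q) (hsub α' q)
    (fun u v => (hs q u v).symm.trans (hs' q u v)) u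
  exact congrFun (congrFun this i) j

end Global

end SU3Structure

end

theorem mainTheorem9
    {M : Type*} [TopologicalSpace M] [ChartedSpace (EuclideanSpace ℝ (Fin 6)) M]
    [IsManifold (𝓡 6) ∞ M]
    {P : Type*} [TopologicalSpace P] [ChartedSpace (EuclideanSpace ℝ (Fin 14)) P]
    [IsManifold (𝓡 14) ∞ P]
    (S : SU3Structure M P) :
    (S.IsNearlyCalabiYau ↔
      ∃ α : Fin 3 → Fin 3 → ∀ p : P, TangentSpace (𝓡 14) p →L[ℝ] ℂ,
        S.IsNearlyCalabiYauConnection α) ∧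
    (∀ α α' : Fin 3 → Fin 3 → ∀ p : P, TangentSpace (𝓡 14) p →L[ℝ] ℂ,
      S.IsNearlyCalabiYauConnection α → S.IsNearlyCalabiYauConnection α' → α = α') := by
  exact ⟨⟨fun h => ⟨_, SU3Structure.isNearlyCalabiYauConnection_canonicalConn h⟩,
    fun ⟨_, h⟩ => h.isNearlyCalabiYau⟩, fun _ _ h h' => h.unique h'⟩
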